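/- Let $n,p$ be fixed, let $X$ be a real $n\times p$ matrix with rows $X_1^T,\dots,X_n^T$, let $Y\in\{0,1\}^n$, $v\in\mathbb{R}^p$, and let $Q\in\mathbb{R}^{p\times p}$ be either positive definite or zero. Let $\phi,\Phi$ be the standard normal density and distribution function, and assume that the probit posterior is proper, i.e. that $$\prod_{i=1}^n \Phi(X_i^T\beta)^{Y_i}\,(1-\Phi(X_i^T\beta))^{1-Y_i}\;\exp\{-\tfrac12(\beta-v)^TQ(\beta-v)\}$$ has a finite integral over $\beta\in\mathbb{R}^p$. Let $\pi(\beta)$ be the corresponding normalized posterior density and put $\Sigma=X^TX+Q$. The Albert--Chib chain moves from $\beta$ to $\beta'$ by drawing independent $Z_i\sim \mathrm{TN}(X_i^T\beta,1;Y_i)$ (the $N(X_i^T\beta,1)$ law truncated to $(0,\infty)$ if $Y_i=1$ and to $(-\infty,0)$ if $Y_i=0$), $i=1,\dots,n$, and then $\beta'\sim N_p(\Sigma^{-1}(X^TZ+Qv),\Sigma^{-1})$. Let $k^{(m)}(\beta,\beta')$ be its $m$-step transition density with respect to Lebesgue measure, and let $\varphi(\beta)=\mathbb{E}(Z\mid B=\beta)\in\mathbb{R}^n$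 be the mean vector of $Z$ when the current state is $\beta$. The posterior density $\pi$ has a unique mode $\hat B$. Let $g(\theta)=\theta\phi(\theta)/\Phi(\theta)+(\phi(\theta)/\Phi(\theta))^2$, let $D(\beta)$ be the $n\times n$ diagonal matrix with $i$th diagonal entry $1-g(X_i^T\beta)$ if $Y_i=1$ and $1-g(-X_i^T\beta)$ if $Y_i=0$, and put $$\lambda=\sup_{t\in(0,1)}\sup_{\alpha\ne0}\frac{\|\Sigma^{-1/2}X^TD(\hat B+t\alpha)X\alpha\|^2}{\|\Sigma^{1/2}\alpha\|^2},\qquad L=p(1+\lambda)$$ (with $\lambda=0$ if $p=0$). Then $\lambda<1$. Moreover, for every $d>2L/(1-\lambda)$ and every $r\in(0,1)$, with $$\varepsilon=2^{-p/2}e^{-d},\qquad \hat\rho=(1-\varepsilon)^r\vee\Big(\frac{1+2L+\lambda d}{1+d}\Big)^{1-r}\{1+2(\lambda d+L)\}^r,$$ one has, for all $m\ge1$ and $\beta\in\mathbb{R}^p$, $$\int_{\mathbb{R}^p}\big|k^{(m)}(\beta,\beta')-\pi(\beta')\big|\,d\beta'\le H(\beta)\,\hat\rho^{\,m-1},$$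 $$H(\beta)=2+\frac{L}{1-\lambda}+\mathrm{tr}\big(X\Sigma^{-1}X^T\big)+\Big\|\Sigma^{1/2}\big\{\Sigma^{-1}(X^T\varphi(\beta)+Qv)-\hat B\big\}\Big\|^2 .$$ -/

import Mathlib

open MeasureTheory ProbabilityTheory Matrix

noncomputable section

namespace ProbitDA

/-- The standard normal density `φ`. -/
def stdPDF (x : ℝ) : ℝ := gaussianPDFReal 0 1 x

/-- The standard normal distribution function `Φ`. -/
def stdCDF (x : ℝ) : ℝ := (gaussianReal 0 1).real (Set.Iic x)

/-- The squared Euclidean norm of a real vector. -/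
def sqNorm {k : ℕ} (u : Fin k → ℝ) : ℝ := ‖WithLp.toLp 2 u‖ ^ 2

open scoped MatrixOrder in
/-- The positive semidefinite square root of a positive semidefinite real matrix. -/
def matSqrt {k : ℕ} (A : Matrix (Fin k) (Fin k) ℝ) : Matrix (Fin k) (Fin k) ℝ := CFC.sqrt A

/-- The density of `N_k(μ, C)` with respect to Lebesgue measure on `ℝ^k`, for a positive definite
covariance matrix `C`. -/
def mvnPDF {k : ℕ} (μ : Fin k → ℝ) (C : Matrix (Fin k) (Fin k) ℝ) (x : Fin k → ℝ) : ℝ :=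
  (Real.sqrt ((2 * Real.pi) ^ k * C.det))⁻¹ *
    Real.exp (-(1 / 2) * ((x - μ) ⬝ᵥ (C⁻¹ *ᵥ (x - μ))))

/-- The density of `TN(θ, 1; y)`: the `N(θ, 1)` distribution truncated to `(0, ∞)` if `y` is
a success (`true`), and to `(-∞, 0)` if `y` is a failure (`false`). -/
def truncNormalPDF (θ : ℝ) (y : Bool) (t : ℝ) : ℝ :=
  if y then
    (Set.Ioi (0 : ℝ)).indicator
      (fun s => gaussianPDFReal θ 1 s / (gaussianReal θ 1).real (Set.Ioi 0)) t
  else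
    (Set.Iio (0 : ℝ)).indicator
      (fun s => gaussianPDFReal θ 1 s / (gaussianReal θ 1).real (Set.Iio 0)) t

/-- The unnormalized prior density `ω(β) = exp(-(β - v)ᵀ Q (β - v) / 2)`. -/
def prior {p : ℕ} (Q : Matrix (Fin p) (Fin p) ℝ) (v : Fin p → ℝ) (β : Fin p → ℝ) : ℝ :=
  Real.exp (-(1 / 2) * ((β - v) ⬝ᵥ (Q *ᵥ (β - v))))

/-- The probit likelihood `∏ i, Φ(X_iᵀ β)^{Y_i} (1 - Φ(X_iᵀ β))^{1 - Y_i}`; the vector `X_i` is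
the `i`th row of `X`, so that `(X *ᵥ β) i = X_iᵀ β`. -/
def likelihood {n p : ℕ} (X : Matrix (Fin n) (Fin p) ℝ) (Y : Fin n → Bool)
    (β : Fin p → ℝ) : ℝ :=
  ∏ i, if Y i then stdCDF ((X *ᵥ β) i) else 1 - stdCDF ((X *ᵥ β) i)

/-- Likelihood times (unnormalized) prior. -/
def unnormPosterior {n p : ℕ} (X : Matrix (Fin n) (Fin p) ℝ) (Y : Fin n → Bool)
    (Q : Matrix (Fin p) (Fin p) ℝ) (v : Fin p → ℝ) (β : Fin p → ℝ) : ℝ :=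
  likelihood X Y β * prior Q v β

/-- The posterior is proper: likelihood times prior has a finite integral over `ℝ^p`. -/
def ProperPosterior {n p : ℕ} (X : Matrix (Fin n) (Fin p) ℝ) (Y : Fin n → Bool)
    (Q : Matrix (Fin p) (Fin p) ℝ) (v : Fin p → ℝ) : Prop :=
  Integrable (unnormPosterior X Y Q v) volume

/-- The posterior density `π(β | Y, X)`. -/
def posterior {n p : ℕ} (X : Matrix (Fin n) (Fin p) ℝ) (Y : Fin n → Bool)
    (Q : Matrix (Fin p) (Fin p) ℝ) (v : Fin p → ℝ) (β : Fin p → ℝ) : ℝ :=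
  unnormPosterior X Y Q v β / ∫ b, unnormPosterior X Y Q v b

/-- `b` is a mode (a global maximizer) of the posterior density. -/
def IsPosteriorMode {n p : ℕ} (X : Matrix (Fin n) (Fin p) ℝ) (Y : Fin n → Bool)
    (Q : Matrix (Fin p) (Fin p) ℝ) (v : Fin p → ℝ) (b : Fin p → ℝ) : Prop :=
  ∀ β, posterior X Y Q v β ≤ posterior X Y Q v b

/-- `Σ = Xᵀ X + Q`. -/
def sigmaMat {n p : ℕ} (X : Matrix (Fin n) (Fin p) ℝ) (Q : Matrix (Fin p) (Fin p) ℝ) :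
    Matrix (Fin p) (Fin p) ℝ :=
  Xᵀ * X + Q

/-- The conditional mean `Σ⁻¹ (Xᵀ z + Q v)` of `B` given `Z = z`. -/
def condMean {n p : ℕ} (X : Matrix (Fin n) (Fin p) ℝ) (Q : Matrix (Fin p) (Fin p) ℝ)
    (v : Fin p → ℝ) (z : Fin n → ℝ) : Fin p → ℝ :=
  (sigmaMat X Q)⁻¹ *ᵥ (Xᵀ *ᵥ z + Q *ᵥ v)

/-- The conditional density of the latent vector `Z` given `B = β`, a product of `n` truncated
normal densities. -/
def latentPDF {n p : ℕ} (X : Matrix (Fin n) (Fin p) ℝ) (Y : Fin n → Bool)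
    (β : Fin p → ℝ) (z : Fin n → ℝ) : ℝ :=
  ∏ i, truncNormalPDF ((X *ᵥ β) i) (Y i) (z i)

/-- The Markov transition density of the Albert--Chib chain: draw `Z` given `B = β`, then draw the
new state from `N_p(Σ⁻¹ (Xᵀ Z + Q v), Σ⁻¹)`. -/
def acMtd {n p : ℕ} (X : Matrix (Fin n) (Fin p) ℝ) (Y : Fin n → Bool)
    (Q : Matrix (Fin p) (Fin p) ℝ) (v : Fin p → ℝ) (β β' : Fin p → ℝ) : ℝ :=
  ∫ z : Fin n → ℝ, mvnPDF (condMean X Q v z) (sigmaMat X Q)⁻¹ β' * latentPDF X Y β z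

/-- The `m`-step Markov transition density of the Albert--Chib chain, for `m ≥ 1`
(the value at `m = 0` is a placeholder, as the `0`-step law has no density). -/
def acMtdStep {n p : ℕ} (X : Matrix (Fin n) (Fin p) ℝ) (Y : Fin n → Bool)
    (Q : Matrix (Fin p) (Fin p) ℝ) (v : Fin p → ℝ) : ℕ → (Fin p → ℝ) → (Fin p → ℝ) → ℝ
  | 0 => fun _ _ => 0
  | 1 => acMtd X Y Q v
  | m + 2 => fun β β' => ∫ b : Fin p → ℝ, acMtd X Y Q v β b * acMtdStep X Y Q v (m + 1) b β'

/-- `φ(β) = E(Z | B = β)`, the vector of truncated normal means. -/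
def latentMean {n p : ℕ} (X : Matrix (Fin n) (Fin p) ℝ) (Y : Fin n → Bool)
    (β : Fin p → ℝ) : Fin n → ℝ :=
  fun i => ∫ z : Fin n → ℝ, z i * latentPDF X Y β z

/-- `g(θ) = θ φ(θ) / Φ(θ) + (φ(θ) / Φ(θ))²`. -/
def gFun (θ : ℝ) : ℝ :=
  θ * stdPDF θ / stdCDF θ + (stdPDF θ / stdCDF θ) ^ 2

/-- The diagonal matrix `D(β)` with diagonal entries `1 - g(X_iᵀ β)` if `Y_i` is a success and
`1 - g(-X_iᵀ β)` if `Y_i` is a failure. -/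
def dMat {n p : ℕ} (X : Matrix (Fin n) (Fin p) ℝ) (Y : Fin n → Bool) (β : Fin p → ℝ) :
    Matrix (Fin n) (Fin n) ℝ :=
  Matrix.diagonal fun i => 1 - if Y i then gFun ((X *ᵥ β) i) else gFun (-(X *ᵥ β) i)

/-- The ratios `‖Σ^{-1/2} Xᵀ D(b + t α) X α‖² / ‖Σ^{1/2} α‖²` for `t ∈ (0, 1)` and `α ≠ 0`. -/
def driftRatios {n p : ℕ} (X : Matrix (Fin n) (Fin p) ℝ) (Y : Fin n → Bool)
    (Q : Matrix (Fin p) (Fin p) ℝ) (b : Fin p → ℝ) : Set ℝ :=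
  {x | ∃ t ∈ Set.Ioo (0 : ℝ) 1, ∃ α : Fin p → ℝ, α ≠ 0 ∧
    x = sqNorm ((matSqrt (sigmaMat X Q))⁻¹ *ᵥ (Xᵀ *ᵥ (dMat X Y (b + t • α) *ᵥ (X *ᵥ α)))) /
      sqNorm (matSqrt (sigmaMat X Q) *ᵥ α)}

/-- The drift parameter `λ`, the supremum of the ratios (equal to `0` when `p = 0`). -/
def driftLambda {n p : ℕ} (X : Matrix (Fin n) (Fin p) ℝ) (Y : Fin n → Bool)
    (Q : Matrix (Fin p) (Fin p) ℝ) (b : Fin p → ℝ) : ℝ :=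
  sSup (driftRatios X Y Q b)

/-- The drift parameter `L = p (1 + λ)`. -/
def driftL (p : ℕ) (lam : ℝ) : ℝ := p * (1 + lam)

/-- The minorization number `ε = 2^{-p/2} e^{-d}`. -/
def minorEps (p : ℕ) (d : ℝ) : ℝ := (2 : ℝ) ^ (-(p : ℝ) / 2) * Real.exp (-d)

/-- The drift-and-minorization rate
`ρ̂ = (1 - ε)^r ∨ ((1 + 2L + λd) / (1 + d))^{1 - r} (1 + 2(λd + L))^r`. -/
def rhoHat (lam L ε d r : ℝ) : ℝ :=
  max ((1 - ε) ^ r)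
    (((1 + 2 * L + lam * d) / (1 + d)) ^ (1 - r) * (1 + 2 * (lam * d + L)) ^ r)

/-- `H(β) = 2 + L/(1-λ) + tr(X Σ⁻¹ Xᵀ) + ‖Σ^{1/2} {Σ⁻¹ (Xᵀ φ(β) + Q v) - b}‖²`. -/
def hBound {n p : ℕ} (X : Matrix (Fin n) (Fin p) ℝ) (Y : Fin n → Bool)
    (Q : Matrix (Fin p) (Fin p) ℝ) (v b : Fin p → ℝ) (lam L : ℝ) (β : Fin p → ℝ) : ℝ :=
  2 + L / (1 - lam) + (X * (sigmaMat X Q)⁻¹ * Xᵀ).trace +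
    sqNorm (matSqrt (sigmaMat X Q) *ᵥ (condMean X Q v (latentMean X Y β) - b))

end ProbitDA

end

/-! The chain alternates two kernels: `latentPDF` sends a state to a latent vector z, and `statePDF`
sends z to a new state. Let V(z) be the squared Σ-norm distance of the conditional mean given z from
the mode (`driftFun`). The mode is a critical point of the log posterior, hence a fixed point of the
expected update. The derivative of the expected latent vector along a ray is given by D, whose
entries 1 - g are truncated normal variances. The mean value theorem with Cauchy–Schwarz therefore
makes the expected update contract squared Σ-distances to the mode by λ (`quad_meanVec_sub_le`). The
latent variance adds at most tr(XΣ⁻¹Xᵀ) ≤ p and the Gaussian draw adds λp, so one round gives the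
drift λV + L. On {V ≤ d} the Gaussian densities share a common part of mass ε (`le_mvnPDF`).

That λ < 1 (`exists_contraction_factor`) rests on three facts. First, XΣ⁻¹Xᵀ is at most the
identity. Second, 0 < g ≤ 1, with g bounded below on left half-lines, by Cauchy–Schwarz for tilted
Gaussian moments. Third, propriety makes every nonzero direction visible: either Q is positive
definite or some signed predictor strictly decreases. A predictor decreasing along a ray stays in a
left half-line, so the gain is uniform although the ray parameters are unbounded. The same
visibility gives Gaussian tails, hence a mode; the contraction makes it unique.

The rate comes from an oscillation argument. Suppose q(z) - q(z') ≤ c(1 + V(z) + V(z'))^s. Replacing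
the concave power by a tangent line makes the bound affine in V, so that drift, or drift with
minorization when both points are small, can be integrated. The operator then multiplies c by κ
(`DriftMinorization.contraction_step`). The exponent s balances the two cases, and κ is then at most
ρ̂ for every r (`exists_contraction_rate`). Comparing with stationarity needs a mean of V under the
posterior; a truncated mean, bounded by L/(1-λ), is enough. Testing against a sign function gives
the L¹ distance. -/

noncomputable section

namespace ProbitDA

/-! ### Half-line moments of an exponentially tilted Gaussian -/

/-- The moments `∫_{u > 0} u ^ k exp (θ u - u² / 2)`. -/
def tiltMoment (k : ℕ) (θ : ℝ) : ℝ := ∫ u in Set.Ioi (0 : ℝ), u ^ k * Real.exp (θ * u - u ^ 2 / 2)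

/-- The square (θ + 2 - u)² absorbs the tilt and leaves a fixed exponential decay, which dominates
every moment integrand. -/
theorem tilt_le (k : ℕ) (θ : ℝ) {u : ℝ} (hu : 0 ≤ u) :
    u ^ k * Real.exp (θ * u - u ^ 2 / 2) ≤
      Real.exp ((θ + 2) ^ 2 / 2) * (u ^ k * Real.exp (-2 * u)) := by
  have h : Real.exp (θ * u - u ^ 2 / 2) ≤ Real.exp ((θ + 2) ^ 2 / 2) * Real.exp (-2 * u) := by
    rw [← Real.exp_add]
    exact Real.exp_le_exp.2 (by nlinarith [sq_nonneg (θ + 2 - u)])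
  calc _ ≤ u ^ k * (Real.exp ((θ + 2) ^ 2 / 2) * Real.exp (-2 * u)) := by gcongr
    _ = _ := by ring

theorem integrableOn_pow_mul_exp (k : ℕ) :
    IntegrableOn (fun u : ℝ => u ^ k * Real.exp (-2 * u)) (Set.Ioi 0) := by
  have h := integrableOn_rpow_mul_exp_neg_mul_rpow (p := 1) (s := k) (b := 2)
    (by linarith [k.cast_nonneg (α := ℝ)]) one_pos two_pos
  refine h.congr_fun (fun u _ => ?_) measurableSet_Ioi
  simp

theorem integrableOn_tilt (k : ℕ) (θ : ℝ) :
    IntegrableOn (fun u : ℝ => u ^ k * Real.exp (θ * u - u ^ 2 / 2)) (Set.Ioi 0) := by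
  refine ((integrableOn_pow_mul_exp k).const_mul (Real.exp ((θ + 2) ^ 2 / 2))).mono'
    (by fun_prop) ?_
  refine (ae_restrict_iff' measurableSet_Ioi).2 (.of_forall fun u hu => ?_)
  have hu' : (0 : ℝ) ≤ u := le_of_lt hu
  rw [Real.norm_of_nonneg (by positivity)]
  exact tilt_le k θ hu'

theorem tendsto_tilt (k : ℕ) (θ : ℝ) :
    Filter.Tendsto (fun u : ℝ => u ^ k * Real.exp (θ * u - u ^ 2 / 2)) Filter.atTop (nhds 0) := by
  have h2 : Filter.Tendsto (fun u : ℝ => u ^ k * Real.exp (-2 * u)) Filter.atTop (nhds 0) := by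
    have := tendsto_rpow_mul_exp_neg_mul_atTop_nhds_zero k 2 two_pos
    simpa using this
  have h3 := h2.const_mul (Real.exp ((θ + 2) ^ 2 / 2))
  rw [mul_zero] at h3
  refine squeeze_zero' ?_ ?_ h3
  · filter_upwards [Filter.eventually_ge_atTop 0] with u hu
    positivity
  · filter_upwards [Filter.eventually_ge_atTop 0] with u hu using tilt_le k θ hu

theorem tiltMoment_pos (k : ℕ) (θ : ℝ) : 0 < tiltMoment k θ := by
  rw [tiltMoment, setIntegral_pos_iff_support_of_nonneg_ae _ (integrableOn_tilt k θ)]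
  · have : (Set.Ioi (0 : ℝ)) ⊆
        Function.support (fun u : ℝ => u ^ k * Real.exp (θ * u - u ^ 2 / 2)) := by
      intro u hu
      have hu' : (0 : ℝ) < u := hu
      exact ne_of_gt (by positivity)
    rw [Set.inter_eq_right.2 this]
    simp
  · refine (ae_restrict_iff' measurableSet_Ioi).2 (.of_forall fun u hu => ?_)
    have hu' : (0 : ℝ) < u := hu
    exact (by positivity : (0 : ℝ) ≤ u ^ k * Real.exp (θ * u - u ^ 2 / 2))

/-- Integrate the derivative of the exponential; the boundary value at 0 supplies the 1. With an
extra power of u that boundary term vanishes, which gives the recursion `tiltMoment_add_two`. -/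
theorem tiltMoment_one (θ : ℝ) : tiltMoment 1 θ = 1 + θ * tiltMoment 0 θ := by
  have h := integral_Ioi_of_hasDerivAt_of_tendsto' (a := (0 : ℝ))
    (f := fun u => u ^ 0 * Real.exp (θ * u - u ^ 2 / 2))
    (f' := fun u => θ * (u ^ 0 * Real.exp (θ * u - u ^ 2 / 2)) -
      u ^ 1 * Real.exp (θ * u - u ^ 2 / 2)) (fun u _ => ?_)
    (by exact ((integrableOn_tilt 0 θ).const_mul θ).sub (integrableOn_tilt 1 θ))
    (tendsto_tilt 0 θ)
  · rw [integral_sub ((integrableOn_tilt 0 θ).const_mul θ) (integrableOn_tilt 1 θ),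
      integral_const_mul] at h
    simp only [tiltMoment]
    norm_num at h ⊢
    linarith
  · have h1 : HasDerivAt (fun u : ℝ => θ * u - u ^ 2 / 2) (θ - u) u := by
      have := ((hasDerivAt_id u).const_mul θ).sub (((hasDerivAt_id u).pow 2).div_const 2)
      refine this.congr_deriv ?_
      simp
    have := h1.exp
    simp only [pow_zero, one_mul, pow_one]
    exact this.congr_deriv (by ring)

theorem tiltMoment_add_two (k : ℕ) (θ : ℝ) :
    tiltMoment (k + 2) θ = (k + 1) * tiltMoment k θ + θ * tiltMoment (k + 1) θ := by
  have i1 := (integrableOn_tilt k θ).const_mul ((k : ℝ) + 1)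
  have i2 := (integrableOn_tilt (k + 1) θ).const_mul θ
  have h := integral_Ioi_of_hasDerivAt_of_tendsto' (a := (0 : ℝ))
    (f := fun u => u ^ (k + 1) * Real.exp (θ * u - u ^ 2 / 2))
    (f' := fun u => ((k : ℝ) + 1) * (u ^ k * Real.exp (θ * u - u ^ 2 / 2)) +
      θ * (u ^ (k + 1) * Real.exp (θ * u - u ^ 2 / 2)) -
      u ^ (k + 2) * Real.exp (θ * u - u ^ 2 / 2)) (fun u _ => ?_)
    (by exact (i1.add i2).sub (integrableOn_tilt (k + 2) θ)) (tendsto_tilt (k + 1) θ)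
  · have e := integral_sub (i1.add i2) (integrableOn_tilt (k + 2) θ)
    have e' := integral_add i1 i2
    simp only [Pi.add_apply] at e
    rw [e, e', integral_const_mul, integral_const_mul] at h
    simp only [tiltMoment]
    simp only [ne_eq, Nat.add_eq_zero_iff, one_ne_zero, and_false, not_false_eq_true, zero_pow,
      zero_mul, sub_zero] at h
    linarith
  · have h1 : HasDerivAt (fun u : ℝ => θ * u - u ^ 2 / 2) (θ - u) u := by
      have := ((hasDerivAt_id u).const_mul θ).sub (((hasDerivAt_id u).pow 2).div_const 2)
      refine this.congr_deriv ?_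
      simp
    have := (hasDerivAt_pow (k + 1) u).mul h1.exp
    refine this.congr_deriv ?_
    rw [Nat.add_sub_cancel]
    push_cast
    ring

/-! ### Normal density, distribution function and inverse Mills ratio -/

theorem stdPDF_pos (θ : ℝ) : 0 < stdPDF θ := gaussianPDFReal_pos _ _ _ one_ne_zero

theorem stdPDF_eq (θ : ℝ) : stdPDF θ = (Real.sqrt (2 * Real.pi))⁻¹ * Real.exp (-(θ ^ 2 / 2)) := by
  simp [stdPDF, gaussianPDFReal, neg_div]

theorem stdPDF_neg (θ : ℝ) : stdPDF (-θ) = stdPDF θ := by simp [stdPDF_eq]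

/-- The factor φ(θ) splits off, so half-line integrals against N(θ, 1) become φ(θ) times tilted
moments. -/
theorem gaussianPDFReal_one_eq (θ u : ℝ) :
    gaussianPDFReal θ 1 u = stdPDF θ * Real.exp (θ * u - u ^ 2 / 2) := by
  rw [stdPDF_eq, mul_assoc, ← Real.exp_add]
  simp only [gaussianPDFReal, NNReal.coe_one, mul_one]
  congr 2
  ring

theorem gaussianReal_real_eq (θ : ℝ) {s : Set ℝ} :
    (gaussianReal θ 1).real s = ∫ u in s, gaussianPDFReal θ 1 u := by
  rw [Measure.real, gaussianReal_apply_eq_integral _ one_ne_zero, ENNReal.toReal_ofReal]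
  exact integral_nonneg fun u => gaussianPDFReal_nonneg _ _ _

theorem gaussianReal_real_Ioi (θ : ℝ) :
    (gaussianReal θ 1).real (Set.Ioi 0) = stdPDF θ * tiltMoment 0 θ := by
  rw [gaussianReal_real_eq, tiltMoment, ← integral_const_mul]
  simp [gaussianPDFReal_one_eq]

theorem gaussianReal_real_Iio (θ : ℝ) :
    (gaussianReal θ 1).real (Set.Iio 0) = stdPDF θ * tiltMoment 0 (-θ) := by
  rw [gaussianReal_real_eq, tiltMoment, ← integral_const_mul, ← integral_Iic_eq_integral_Iio,
    ← neg_zero, ← integral_comp_neg_Ioi, neg_zero]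
  simp [gaussianPDFReal_one_eq]

/-- The reflection x ↦ θ - x carries N(0, 1) to N(θ, 1) and (-∞, θ) to (0, ∞). -/
theorem stdCDF_eq (θ : ℝ) : stdCDF θ = stdPDF θ * tiltMoment 0 θ := by
  rw [← gaussianReal_real_Ioi]
  have h : gaussianReal θ 1 = (gaussianReal 0 1).map (fun x => θ - x) := by
    rw [gaussianReal_map_const_sub]
    simp
  rw [h, map_measureReal_apply (by fun_prop) measurableSet_Ioi, stdCDF]
  have hs : (fun x => θ - x) ⁻¹' Set.Ioi 0 = Set.Iio θ := by
    ext x; simp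
  rw [hs]
  have := nullSingletonClass_gaussianReal (μ := 0) (v := 1) one_ne_zero
  exact (measureReal_congr Iio_ae_eq_Iic).symm

theorem stdCDF_pos (θ : ℝ) : 0 < stdCDF θ := by
  rw [stdCDF_eq]
  exact mul_pos (stdPDF_pos _) (tiltMoment_pos _ _)

theorem one_sub_stdCDF (θ : ℝ) : 1 - stdCDF θ = stdCDF (-θ) := by
  have h1 : (gaussianReal (-θ) 1).real (Set.Ioi 0) = stdCDF (-θ) := by
    rw [stdCDF_eq, gaussianReal_real_Ioi]
  have h2 : (gaussianReal (-θ) 1).real (Set.Iio 0) = stdCDF θ := by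
    rw [stdCDF_eq, gaussianReal_real_Iio, stdPDF_neg, neg_neg]
  have := nullSingletonClass_gaussianReal (μ := (-θ)) (v := 1) one_ne_zero
  have h3 : (gaussianReal (-θ) 1).real (Set.Iic 0) = stdCDF θ := by
    rw [← h2]; exact (measureReal_congr Iio_ae_eq_Iic).symm
  have h4 := probReal_compl_eq_one_sub (μ := gaussianReal (-θ) 1) (s := Set.Iic 0)
    measurableSet_Iic
  rw [Set.compl_Iic, h1, h3] at h4
  exact h4.symm

theorem stdCDF_mono : Monotone stdCDF := fun _ _ h =>
  measureReal_mono (Set.Iic_subset_Iic.2 h)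

theorem continuous_stdPDF : Continuous stdPDF := by
  have : stdPDF = fun θ => (Real.sqrt (2 * Real.pi))⁻¹ * Real.exp (-(θ ^ 2 / 2)) :=
    funext stdPDF_eq
  rw [this]
  fun_prop

theorem hasDerivAt_stdPDF (θ : ℝ) : HasDerivAt stdPDF (-θ * stdPDF θ) θ := by
  have : stdPDF = fun θ => (Real.sqrt (2 * Real.pi))⁻¹ * Real.exp (-(θ ^ 2 / 2)) :=
    funext stdPDF_eq
  rw [this]
  have h1 : HasDerivAt (fun u : ℝ => -(u ^ 2 / 2)) (-θ) θ := by
    have := (((hasDerivAt_id θ).pow 2).div_const 2).neg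
    refine this.congr_deriv ?_
    simp
  exact (h1.exp.const_mul _).congr_deriv (by ring)

theorem hasDerivAt_stdCDF (θ : ℝ) : HasDerivAt stdCDF (stdPDF θ) θ := by
  have hi : ∀ s, IntegrableOn stdPDF s := fun s =>
    (integrable_gaussianPDFReal 0 1).integrableOn
  have h : stdCDF = fun x => (∫ u in Set.Iic (0 : ℝ), stdPDF u) + ∫ u in (0 : ℝ)..x, stdPDF u := by
    ext x
    rw [stdCDF, gaussianReal_real_eq, ← intervalIntegral.integral_Iic_sub_Iic (hi _) (hi _)]
    simp [stdPDF]
  rw [h]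
  refine HasDerivAt.const_add _ ?_
  exact intervalIntegral.integral_hasDerivAt_right (continuous_stdPDF.intervalIntegrable _ _)
    continuous_stdPDF.stronglyMeasurable.stronglyMeasurableAtFilter continuous_stdPDF.continuousAt

theorem continuous_stdCDF : Continuous stdCDF :=
  continuous_iff_continuousAt.2 fun θ => (hasDerivAt_stdCDF θ).continuousAt

/-- The inverse Mills ratio `φ / Φ`. -/
def mills (θ : ℝ) : ℝ := stdPDF θ / stdCDF θ

theorem mills_eq (θ : ℝ) : mills θ = (tiltMoment 0 θ)⁻¹ := by
  rw [mills, stdCDF_eq, div_mul_cancel_left₀ (stdPDF_pos θ).ne']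

theorem mills_pos (θ : ℝ) : 0 < mills θ := div_pos (stdPDF_pos _) (stdCDF_pos _)

theorem gFun_eq (θ : ℝ) : gFun θ = mills θ * (θ + mills θ) := by
  rw [gFun, mills]; ring

theorem hasDerivAt_mills (θ : ℝ) : HasDerivAt mills (-gFun θ) θ := by
  refine ((hasDerivAt_stdPDF θ).div (hasDerivAt_stdCDF θ) (stdCDF_pos θ).ne').congr_deriv ?_
  have := (stdCDF_pos θ).ne'
  rw [gFun]
  field_simp
  ring

theorem continuous_mills : Continuous mills :=
  continuous_iff_continuousAt.2 fun θ => (hasDerivAt_mills θ).continuousAt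

theorem continuous_gFun : Continuous gFun := by
  have : gFun = fun θ => mills θ * (θ + mills θ) := funext gFun_eq
  rw [this]
  have := continuous_mills
  fun_prop

/-- This ratio is the mean of N(θ, 1) truncated to the positive half-line, which makes its
positivity, and that of g, immediate. -/
theorem add_mills_eq (θ : ℝ) : θ + mills θ = tiltMoment 1 θ / tiltMoment 0 θ := by
  have := (tiltMoment_pos 0 θ).ne'
  rw [mills_eq, tiltMoment_one]
  field_simp
  ring

theorem add_mills_pos (θ : ℝ) : 0 < θ + mills θ := by
  rw [add_mills_eq]
  exact div_pos (tiltMoment_pos _ _) (tiltMoment_pos _ _)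

theorem gFun_pos (θ : ℝ) : 0 < gFun θ := by
  rw [gFun_eq]
  exact mul_pos (mills_pos θ) (add_mills_pos θ)

/-! ### Bounds on g from moment inequalities -/

theorem tiltMoment_quadratic_nonneg (k : ℕ) (θ c : ℝ) :
    0 ≤ tiltMoment (k + 2) θ - 2 * c * tiltMoment (k + 1) θ + c ^ 2 * tiltMoment k θ := by
  have i0 := (integrableOn_tilt k θ).const_mul (c ^ 2)
  have i1 := (integrableOn_tilt (k + 1) θ).const_mul (2 * c)
  have i2 := integrableOn_tilt (k + 2) θ
  have e : tiltMoment (k + 2) θ - 2 * c * tiltMoment (k + 1) θ + c ^ 2 * tiltMoment k θ =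
      ∫ u in Set.Ioi (0 : ℝ), u ^ k * Real.exp (θ * u - u ^ 2 / 2) * (u - c) ^ 2 := by
    simp only [tiltMoment]
    rw [← integral_const_mul, ← integral_const_mul, ← integral_sub i2 i1]
    have := integral_add (i2.sub i1) i0
    simp only [Pi.sub_apply] at this
    rw [← this]
    refine integral_congr_ae (.of_forall fun u => ?_)
    ring
  rw [e]
  refine setIntegral_nonneg measurableSet_Ioi fun u hu => ?_
  have hu' : (0 : ℝ) < u := hu
  positivity

/-- Cauchy–Schwarz: the nonnegative quadratic in c is evaluated at its minimizer. -/
theorem tiltMoment_sq_le (k : ℕ) (θ : ℝ) :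
    tiltMoment (k + 1) θ ^ 2 ≤ tiltMoment k θ * tiltMoment (k + 2) θ := by
  have h := tiltMoment_quadratic_nonneg k θ (tiltMoment (k + 1) θ / tiltMoment k θ)
  have hp := tiltMoment_pos k θ
  have h2 := mul_nonneg hp.le h
  have : tiltMoment k θ * (tiltMoment (k + 2) θ -
      2 * (tiltMoment (k + 1) θ / tiltMoment k θ) * tiltMoment (k + 1) θ +
      (tiltMoment (k + 1) θ / tiltMoment k θ) ^ 2 * tiltMoment k θ) =
      tiltMoment k θ * tiltMoment (k + 2) θ - tiltMoment (k + 1) θ ^ 2 := by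
    field_simp
    ring
  linarith

theorem tiltMoment_one_div (θ : ℝ) :
    tiltMoment 1 θ = tiltMoment 0 θ * (θ + mills θ) := by
  have := (tiltMoment_pos 0 θ).ne'
  rw [add_mills_eq]
  field_simp

theorem tiltMoment_two (θ : ℝ) :
    tiltMoment 2 θ = tiltMoment 0 θ * (1 + θ * (θ + mills θ)) := by
  rw [tiltMoment_add_two 0, zero_add, tiltMoment_one_div]
  push_cast
  ring

/-- Since 1 - g is the variance of the truncated law, this is Cauchy–Schwarz for the moments of
order 0, 1, 2. -/
theorem gFun_le_one (θ : ℝ) : gFun θ ≤ 1 := by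
  have h := tiltMoment_sq_le 0 θ
  rw [zero_add, zero_add, tiltMoment_one_div, tiltMoment_two] at h
  have hp := tiltMoment_pos 0 θ
  have h' : (θ + mills θ) ^ 2 ≤ 1 + θ * (θ + mills θ) := by
    have hpp : 0 < tiltMoment 0 θ ^ 2 := by positivity
    refine le_of_mul_le_mul_left ?_ hpp
    nlinarith
  rw [gFun_eq]
  nlinarith

/-- Cauchy–Schwarz one degree higher, for the moments 1, 2, 3. With q = θ + φ/Φ the recursion
reduces it to 1 + θq ≤ 2q²; as g = q² - θq, this says 2g ≥ 1 - θq, which is at least 1 for θ ≤ 0. -/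
theorem half_le_gFun {θ : ℝ} (hθ : θ ≤ 0) : 1 / 2 ≤ gFun θ := by
  have h := tiltMoment_sq_le 1 θ
  rw [tiltMoment_add_two 1] at h
  norm_num at h
  rw [tiltMoment_one_div, tiltMoment_two] at h
  have hp := tiltMoment_pos 0 θ
  set q := θ + mills θ with hq
  have hq0 : 0 < q := add_mills_pos θ
  have h' : (1 + θ * q) ^ 2 ≤ q * (2 * q + θ * (1 + θ * q)) := by
    have hpp : 0 < tiltMoment 0 θ ^ 2 := by positivity
    refine le_of_mul_le_mul_left ?_ hpp
    nlinarith
  rw [gFun_eq, ← hq]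
  have hm : mills θ = q - θ := by rw [hq]; ring
  rw [hm]
  nlinarith [mul_nonneg hq0.le (neg_nonneg.2 hθ)]

/-- On a left half-line the truncated normal variance stays away from one. -/
theorem exists_gFun_lower_bound (c : ℝ) : ∃ δ > 0, ∀ θ ≤ c, δ ≤ gFun θ := by
  obtain ⟨x, -, hx⟩ := isCompact_Icc.exists_isMinOn (s := Set.Icc (-|c|) |c|)
    ⟨|c|, by constructor <;> linarith [abs_nonneg c]⟩ continuous_gFun.continuousOn
  refine ⟨min (1 / 2) (gFun x), lt_min (by norm_num) (gFun_pos x), fun θ hθ => ?_⟩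
  -- The unbounded side is covered by the constant 1/2; compactness is needed only between 0 and c.
  rcases le_total θ 0 with h | h
  · exact (min_le_left _ _).trans (half_le_gFun h)
  · refine (min_le_right _ _).trans (hx ⟨?_, hθ.trans (le_abs_self c)⟩)
    linarith [abs_nonneg c]

/-! ### Truncated normal laws and their first two moments -/

/-- The sign `±1` attached to a binary response. -/
def sgn (y : Bool) : ℝ := if y then 1 else -1

theorem sgn_mul_self (y : Bool) : sgn y * sgn y = 1 := by cases y <;> simp [sgn]

/-- The density of the standard truncated normal law on the positive half-line. -/
def posTruncPDF (θ u : ℝ) : ℝ :=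
  (Set.Ioi (0 : ℝ)).indicator (fun u => Real.exp (θ * u - u ^ 2 / 2) / tiltMoment 0 θ) u

/-- The reflection t ↦ -t turns a failure into a success, so one half-line computation serves both
responses. -/
theorem truncNormalPDF_eq (θ : ℝ) (y : Bool) (t : ℝ) :
    truncNormalPDF θ y t = posTruncPDF (sgn y * θ) (sgn y * t) := by
  have hφ := (stdPDF_pos θ).ne'
  cases y
  · by_cases ht : t < 0
    · have h' : 0 < -t := by linarith
      simp only [truncNormalPDF, posTruncPDF, sgn, Bool.false_eq_true, ↓reduceIte, neg_one_mul]
      rw [Set.indicator_of_mem (show t ∈ Set.Iio 0 from ht),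
        Set.indicator_of_mem (show -t ∈ Set.Ioi 0 from h'), gaussianReal_real_Iio,
        gaussianPDFReal_one_eq, mul_div_mul_left _ _ hφ]
      congr 2
      ring
    · simp [truncNormalPDF, posTruncPDF, sgn, ht]
  · by_cases ht : 0 < t
    · simp only [truncNormalPDF, posTruncPDF, sgn, ↓reduceIte, one_mul]
      rw [Set.indicator_of_mem (show t ∈ Set.Ioi 0 from ht),
        Set.indicator_of_mem (show t ∈ Set.Ioi 0 from ht), gaussianReal_real_Ioi,
        gaussianPDFReal_one_eq, mul_div_mul_left _ _ hφ]
    · simp [truncNormalPDF, posTruncPDF, sgn, ht]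

theorem tiltMoment_zero_eq_inv_mills (θ : ℝ) : tiltMoment 0 θ = (mills θ)⁻¹ := by
  rw [mills_eq, inv_inv]

theorem truncNormalPDF_nonneg (θ : ℝ) (y : Bool) (t : ℝ) : 0 ≤ truncNormalPDF θ y t := by
  rw [truncNormalPDF_eq]
  refine Set.indicator_nonneg (fun u _ => ?_) _
  exact div_nonneg (Real.exp_pos _).le (tiltMoment_pos _ _).le

theorem measurable_truncNormalPDF (y : Bool) :
    Measurable (fun x : ℝ × ℝ => truncNormalPDF x.1 y x.2) := by
  have h : (fun x : ℝ × ℝ => truncNormalPDF x.1 y x.2) =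
      (fun x : ℝ × ℝ => posTruncPDF x.1 x.2) ∘ fun x => (sgn y * x.1, sgn y * x.2) := by
    ext x; simp [truncNormalPDF_eq]
  rw [h]
  refine Measurable.comp ?_ (by fun_prop)
  have h2 : (fun x : ℝ × ℝ => posTruncPDF x.1 x.2) =
      {x : ℝ × ℝ | 0 < x.2}.indicator
        (fun x => Real.exp (x.1 * x.2 - x.2 ^ 2 / 2) / (mills x.1)⁻¹) := by
    ext x
    simp only [posTruncPDF, Set.indicator, Set.mem_Ioi, Set.mem_ofPred_eq,
      tiltMoment_zero_eq_inv_mills]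
  rw [h2]
  refine Measurable.indicator ?_ (measurableSet_lt measurable_const measurable_snd)
  have := continuous_mills.measurable
  fun_prop

theorem posTruncPDF_mul (θ : ℝ) (k : ℕ) :
    (fun u => u ^ k * posTruncPDF θ u) = (Set.Ioi (0 : ℝ)).indicator
      (fun u => u ^ k * Real.exp (θ * u - u ^ 2 / 2) / tiltMoment 0 θ) := by
  ext u
  by_cases h : 0 < u <;> simp [posTruncPDF, h, mul_div_assoc]

theorem integrable_pow_mul_posTruncPDF (θ : ℝ) (k : ℕ) :
    Integrable (fun u => u ^ k * posTruncPDF θ u) := by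
  rw [posTruncPDF_mul, integrable_indicator_iff measurableSet_Ioi]
  exact (integrableOn_tilt k θ).div_const _

theorem integral_pow_mul_posTruncPDF (θ : ℝ) (k : ℕ) :
    ∫ u, u ^ k * posTruncPDF θ u = tiltMoment k θ / tiltMoment 0 θ := by
  rw [posTruncPDF_mul, integral_indicator measurableSet_Ioi, integral_div]
  rfl

theorem integrable_pow_mul_truncNormalPDF (θ : ℝ) (y : Bool) (k : ℕ) :
    Integrable (fun t => t ^ k * truncNormalPDF θ y t) := by
  have h := integrable_pow_mul_posTruncPDF (sgn y * θ) k
  cases y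
  · have h2 := h.comp_neg.const_mul ((-1) ^ k)
    refine h2.congr (.of_forall fun t => ?_)
    simp only [truncNormalPDF_eq, sgn]
    rw [← mul_assoc, ← mul_pow]
    simp
  · simpa [truncNormalPDF_eq, sgn] using h

theorem integral_pow_mul_truncNormalPDF (θ : ℝ) (y : Bool) (k : ℕ) :
    ∫ t, t ^ k * truncNormalPDF θ y t =
      sgn y ^ k * (tiltMoment k (sgn y * θ) / tiltMoment 0 (sgn y * θ)) := by
  rw [← integral_pow_mul_posTruncPDF, ← integral_const_mul]
  cases y
  · rw [← integral_neg_eq_self]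
    refine integral_congr_ae (.of_forall fun t => ?_)
    simp only [truncNormalPDF_eq, sgn]
    simp only [Bool.false_eq_true, ↓reduceIte, neg_mul, one_mul, neg_neg]
    rw [← mul_assoc, ← mul_pow]
    simp
  · simp [truncNormalPDF_eq, sgn]

theorem integral_truncNormalPDF (θ : ℝ) (y : Bool) : ∫ t, truncNormalPDF θ y t = 1 := by
  have := integral_pow_mul_truncNormalPDF θ y 0
  simpa [(tiltMoment_pos 0 _).ne'] using this

/-- The mean of the truncated normal law. -/
def truncMean (θ : ℝ) (y : Bool) : ℝ := θ + sgn y * mills (sgn y * θ)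

theorem integral_mul_truncNormalPDF (θ : ℝ) (y : Bool) :
    ∫ t, t * truncNormalPDF θ y t = truncMean θ y := by
  have := integral_pow_mul_truncNormalPDF θ y 1
  simp only [pow_one] at this
  rw [this, ← add_mills_eq, truncMean, mul_add, ← mul_assoc, sgn_mul_self, one_mul]

theorem integral_sq_mul_truncNormalPDF (θ : ℝ) (y : Bool) :
    ∫ t, t ^ 2 * truncNormalPDF θ y t = truncMean θ y ^ 2 + (1 - gFun (sgn y * θ)) := by
  rw [integral_pow_mul_truncNormalPDF, tiltMoment_two, gFun_eq, truncMean,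
    mul_div_cancel_left₀ _ (tiltMoment_pos 0 _).ne']
  cases y <;> simp only [sgn] <;> norm_num <;> ring

/-- The derivative of the mean equals the variance. Hence the entries of D are both the derivatives
of the expected latent vector and the latent variances. -/
theorem hasDerivAt_truncMean (θ : ℝ) (y : Bool) :
    HasDerivAt (fun x => truncMean x y) (1 - gFun (sgn y * θ)) θ := by
  have h1 : HasDerivAt (fun x => sgn y * x) (sgn y) θ := by
    simpa using (hasDerivAt_id θ).const_mul (sgn y)
  have h2 := (hasDerivAt_mills (sgn y * θ)).comp θ h1
  have h3 := (hasDerivAt_id θ).add (h2.const_mul (sgn y))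
  refine h3.congr_deriv ?_
  linear_combination (-gFun (sgn y * θ)) * sgn_mul_self y

/-! ### Quadratic forms under product densities -/

section ProductMoments

variable {n : ℕ} {f : Fin n → ℝ → ℝ} {m s : Fin n → ℝ}

theorem integrable_monomial_mul_prod (hI : ∀ i k, Integrable (fun t => t ^ k * f i t))
    (a : Fin n → ℕ) :
    Integrable (fun x : Fin n → ℝ => (∏ k, x k ^ a k) * ∏ k, f k (x k)) := by
  simp_rw [← Finset.prod_mul_distrib]
  exact Integrable.fintype_prod (f := fun i t => t ^ a i * f i t) fun i => hI i _

theorem integral_monomial_mul_prod (a : Fin n → ℕ) :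
    ∫ x : Fin n → ℝ, (∏ k, x k ^ a k) * ∏ k, f k (x k) = ∏ k, ∫ t, t ^ a k * f k t := by
  simp_rw [← Finset.prod_mul_distrib]
  exact integral_fintype_prod_volume_eq_prod (fun i t => t ^ a i * f i t)

theorem prod_pow_single (x : Fin n → ℝ) (i : Fin n) :
    ∏ k, x k ^ (Pi.single i 1 : Fin n → ℕ) k = x i := by
  rw [Finset.prod_eq_single i]
  · simp
  · intro k _ hk; simp [hk]
  · simp

theorem prod_pow_single_add (x : Fin n → ℝ) (i j : Fin n) :
    ∏ k, x k ^ (Pi.single i 1 + Pi.single j 1 : Fin n → ℕ) k = x i * x j := by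
  simp_rw [Pi.add_apply, pow_add, Finset.prod_mul_distrib, prod_pow_single]

theorem integrable_prod_density (hI : ∀ i k, Integrable (fun t => t ^ k * f i t)) :
    Integrable (fun x : Fin n → ℝ => ∏ k, f k (x k)) := by
  simpa using integrable_monomial_mul_prod hI 0

theorem integrable_coord_mul (hI : ∀ i k, Integrable (fun t => t ^ k * f i t)) (i : Fin n) :
    Integrable (fun x : Fin n → ℝ => x i * ∏ k, f k (x k)) := by
  simpa [prod_pow_single] using integrable_monomial_mul_prod hI (Pi.single i 1)

theorem integrable_coord_mul_coord_mul (hI : ∀ i k, Integrable (fun t => t ^ k * f i t))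
    (i j : Fin n) : Integrable (fun x : Fin n → ℝ => x i * x j * ∏ k, f k (x k)) := by
  have h := integrable_monomial_mul_prod hI (Pi.single i 1 + Pi.single j 1)
  simp only [prod_pow_single_add] at h
  exact h

theorem integral_prod_density (h0 : ∀ i, ∫ t, f i t = 1) :
    ∫ x : Fin n → ℝ, ∏ k, f k (x k) = 1 := by
  simpa [h0] using integral_monomial_mul_prod (f := f) 0

theorem integral_coord_mul (h0 : ∀ i, ∫ t, f i t = 1) (h1 : ∀ i, ∫ t, t * f i t = m i)
    (i : Fin n) : ∫ x : Fin n → ℝ, x i * ∏ k, f k (x k) = m i := by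
  have h := integral_monomial_mul_prod (f := f) (Pi.single i 1)
  simp only [prod_pow_single] at h
  rw [h, Finset.prod_eq_single i]
  · simp [h1]
  · intro k _ hk; simp [hk, h0]
  · simp

theorem integral_coord_mul_coord_mul (h0 : ∀ i, ∫ t, f i t = 1)
    (h1 : ∀ i, ∫ t, t * f i t = m i) (h2 : ∀ i, ∫ t, t ^ 2 * f i t = m i ^ 2 + s i)
    (i j : Fin n) : ∫ x : Fin n → ℝ, x i * x j * ∏ k, f k (x k) =
      m i * m j + if i = j then s i else 0 := by
  have h := integral_monomial_mul_prod (f := f) (Pi.single i 1 + Pi.single j 1)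
  simp only [prod_pow_single_add] at h
  rw [h]
  by_cases hij : i = j
  · subst hij
    rw [Finset.prod_eq_single i]
    · simp [h2]; ring
    · intro k _ hk; simp [hk, h0]
    · simp
  · rw [← Finset.mul_prod_erase _ _ (Finset.mem_univ i),
      ← Finset.mul_prod_erase _ _ (Finset.mem_erase.2 ⟨Ne.symm hij, Finset.mem_univ j⟩),
      Finset.prod_eq_one]
    · simp [h1, hij, Ne.symm hij]
    · intro k hk
      simp only [Finset.mem_erase] at hk
      simp [hk.1, hk.2.1, h0]

theorem quad_sub_eq_sum (P : Matrix (Fin n) (Fin n) ℝ) (x c : Fin n → ℝ) :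
    (x - c) ⬝ᵥ (P *ᵥ (x - c)) = ∑ i, ∑ j, P i j * ((x i - c i) * (x j - c j)) := by
  simp only [dotProduct, mulVec, Finset.mul_sum, Pi.sub_apply]
  exact Finset.sum_congr rfl fun i _ => Finset.sum_congr rfl fun j _ => by ring

theorem centered_expand (x c : Fin n → ℝ) (i j : Fin n) (q : ℝ) :
    (x i - c i) * (x j - c j) * q =
      x i * x j * q - c i * (x j * q) - c j * (x i * q) + c i * c j * q := by ring

theorem integrable_centered (hI : ∀ i k, Integrable (fun t => t ^ k * f i t)) (c : Fin n → ℝ)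
    (i j : Fin n) :
    Integrable (fun x : Fin n → ℝ => (x i - c i) * (x j - c j) * ∏ k, f k (x k)) := by
  simp_rw [centered_expand]
  exact (((integrable_coord_mul_coord_mul hI i j).sub
    ((integrable_coord_mul hI j).const_mul _)).sub
    ((integrable_coord_mul hI i).const_mul _)).add ((integrable_prod_density hI).const_mul _)

theorem integral_centered (hI : ∀ i k, Integrable (fun t => t ^ k * f i t))
    (h0 : ∀ i, ∫ t, f i t = 1) (h1 : ∀ i, ∫ t, t * f i t = m i)
    (h2 : ∀ i, ∫ t, t ^ 2 * f i t = m i ^ 2 + s i) (c : Fin n → ℝ) (i j : Fin n) :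
    ∫ x : Fin n → ℝ, (x i - c i) * (x j - c j) * ∏ k, f k (x k) =
      (m i - c i) * (m j - c j) + if i = j then s i else 0 := by
  simp_rw [centered_expand]
  have a1 := integrable_coord_mul_coord_mul hI i j
  have a2 := (integrable_coord_mul hI j).const_mul (c i)
  have a3 := (integrable_coord_mul hI i).const_mul (c j)
  have a4 := (integrable_prod_density hI).const_mul (c i * c j)
  rw [integral_add ?_ a4, integral_sub ?_ a3, integral_sub a1 a2,
    integral_const_mul, integral_const_mul, integral_const_mul,
    integral_coord_mul_coord_mul h0 h1 h2, integral_coord_mul h0 h1, integral_coord_mul h0 h1,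
    integral_prod_density h0]
  · ring
  · exact a1.sub a2
  · exact (a1.sub a2).sub a3

theorem integrable_quad_mul_prod (hI : ∀ i k, Integrable (fun t => t ^ k * f i t))
    (P : Matrix (Fin n) (Fin n) ℝ) (c : Fin n → ℝ) :
    Integrable (fun x : Fin n → ℝ => (x - c) ⬝ᵥ (P *ᵥ (x - c)) * ∏ k, f k (x k)) := by
  simp_rw [quad_sub_eq_sum, Finset.sum_mul, mul_assoc (P _ _)]
  exact integrable_finsetSum _ fun i _ => integrable_finsetSum _ fun j _ =>
    (integrable_centered hI c i j).const_mul _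

/-- Independence kills the off-diagonal covariances, so beyond the value at the mean only the
diagonal of P contributes. -/
theorem integral_quad_mul_prod (hI : ∀ i k, Integrable (fun t => t ^ k * f i t))
    (h0 : ∀ i, ∫ t, f i t = 1) (h1 : ∀ i, ∫ t, t * f i t = m i)
    (h2 : ∀ i, ∫ t, t ^ 2 * f i t = m i ^ 2 + s i)
    (P : Matrix (Fin n) (Fin n) ℝ) (c : Fin n → ℝ) :
    ∫ x : Fin n → ℝ, (x - c) ⬝ᵥ (P *ᵥ (x - c)) * ∏ k, f k (x k) =
      (m - c) ⬝ᵥ (P *ᵥ (m - c)) + ∑ i, P i i * s i := by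
  simp_rw [quad_sub_eq_sum, Finset.sum_mul, mul_assoc (P _ _)]
  have hint : ∀ i j, Integrable (fun x : Fin n → ℝ =>
      P i j * ((x i - c i) * (x j - c j) * ∏ k, f k (x k))) := fun i j =>
    (integrable_centered hI c i j).const_mul _
  rw [integral_finsetSum _ fun i _ => integrable_finsetSum _ fun j _ => hint i j,
    ← Finset.sum_add_distrib]
  refine Finset.sum_congr rfl fun i _ => ?_
  rw [integral_finsetSum _ fun j _ => hint i j]
  simp_rw [integral_const_mul, integral_centered hI h0 h1 h2, mul_add, Finset.sum_add_distrib]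
  congr 1
  simp

end ProductMoments

/-! ### Mahalanobis norms through the matrix square root -/

section Sqrt

variable {k : ℕ} {A : Matrix (Fin k) (Fin k) ℝ}

theorem sqNorm_eq (u : Fin k → ℝ) : sqNorm u = u ⬝ᵥ u := by
  rw [sqNorm, EuclideanSpace.real_norm_sq_eq]
  simp [dotProduct, sq]

theorem sqNorm_nonneg (u : Fin k → ℝ) : 0 ≤ sqNorm u := by
  rw [sqNorm]; positivity

open scoped MatrixOrder in
theorem matSqrt_mul_self (hA : A.PosSemidef) : matSqrt A * matSqrt A = A :=
  CFC.sqrt_mul_sqrt_self A hA.nonneg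

open scoped MatrixOrder in
theorem transpose_matSqrt : (matSqrt A)ᵀ = matSqrt A := by
  have h : (CFC.sqrt A).PosSemidef := (CFC.sqrt_nonneg A).posSemidef
  have := h.isHermitian
  rwa [IsHermitian, conjTranspose_eq_transpose_of_trivial] at this

theorem det_matSqrt_sq (hA : A.PosSemidef) : (matSqrt A).det ^ 2 = A.det := by
  rw [sq, ← det_mul, matSqrt_mul_self hA]

theorem det_matSqrt_ne_zero (hA : A.PosDef) : (matSqrt A).det ≠ 0 := by
  have h := det_matSqrt_sq hA.posSemidef
  intro h0
  rw [h0] at h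
  exact hA.det_pos.ne' (by rw [← h]; simp)

theorem sqNorm_matSqrt_mulVec (hA : A.PosSemidef) (x : Fin k → ℝ) :
    sqNorm (matSqrt A *ᵥ x) = x ⬝ᵥ (A *ᵥ x) := by
  conv_rhs => rw [← matSqrt_mul_self hA, ← mulVec_mulVec, dotProduct_mulVec, ← mulVec_transpose,
    transpose_matSqrt]
  rw [sqNorm_eq]

theorem sqNorm_inv_matSqrt_mulVec (hA : A.PosSemidef) (y : Fin k → ℝ) :
    sqNorm ((matSqrt A)⁻¹ *ᵥ y) = y ⬝ᵥ (A⁻¹ *ᵥ y) := by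
  have h : A⁻¹ = (matSqrt A)⁻¹ * (matSqrt A)⁻¹ := by
    rw [← Matrix.mul_inv_rev, matSqrt_mul_self hA]
  rw [h, ← mulVec_mulVec, dotProduct_mulVec, ← mulVec_transpose, transpose_nonsing_inv,
    transpose_matSqrt, sqNorm_eq]

end Sqrt

/-! ### Multivariate Gaussian integrals and minorization -/

section Gaussian

variable {k : ℕ} {S : Matrix (Fin k) (Fin k) ℝ}

theorem mvnPDF_inv (hS : S.PosDef) (w x : Fin k → ℝ) :
    mvnPDF w S⁻¹ x = (Real.sqrt ((2 * Real.pi) ^ k))⁻¹ * |(matSqrt S).det| *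
      Real.exp (-(1 / 2) * ((x - w) ⬝ᵥ (S *ᵥ (x - w)))) := by
  rw [mvnPDF, nonsing_inv_nonsing_inv _ (isUnit_iff_ne_zero.2 hS.det_pos.ne')]
  congr 1
  have h : (S⁻¹).det = ((matSqrt S).det ^ 2)⁻¹ := by
    rw [det_nonsing_inv, Ring.inverse_eq_inv', det_matSqrt_sq hS.posSemidef]
  rw [h, Real.sqrt_mul (by positivity), Real.sqrt_inv, Real.sqrt_sq_eq_abs, mul_inv, inv_inv]

theorem prod_stdPDF (u : Fin k → ℝ) :
    ∏ i, stdPDF (u i) = (Real.sqrt ((2 * Real.pi) ^ k))⁻¹ * Real.exp (-(1 / 2) * (u ⬝ᵥ u)) := by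
  simp_rw [stdPDF_eq, Finset.prod_mul_distrib, ← Real.exp_sum]
  congr 1
  · rw [Finset.prod_const, Finset.card_univ, Fintype.card_fin, inv_pow]
    congr 1
    rw [Real.sqrt_eq_rpow, Real.sqrt_eq_rpow, ← Real.rpow_natCast, ← Real.rpow_natCast,
      ← Real.rpow_mul (by positivity), ← Real.rpow_mul (by positivity), mul_comm (k : ℝ)]
  · congr 1
    rw [dotProduct, Finset.mul_sum]
    exact Finset.sum_congr rfl fun i _ => by ring

/-- Standardizing by x ↦ S^{1/2}(x - w) reduces Gaussian integrals to the product densities above.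
-/
theorem mvnPDF_eq_prod (hS : S.PosDef) (w x : Fin k → ℝ) :
    mvnPDF w S⁻¹ x = |(matSqrt S).det| * ∏ i, stdPDF ((matSqrt S *ᵥ (x - w)) i) := by
  rw [mvnPDF_inv hS, prod_stdPDF, ← sqNorm_eq, sqNorm_matSqrt_mulVec hS.posSemidef]
  ring

theorem integrable_comp_mulVec {R : Matrix (Fin k) (Fin k) ℝ} (hR : R.det ≠ 0)
    {F : (Fin k → ℝ) → ℝ} (hF : Integrable F) : Integrable (fun x => F (R *ᵥ x)) := by
  have hm := Real.map_matrix_volume_pi_eq_smul_volume_pi hR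
  have hF' : Integrable F (Measure.map (toLin' R) volume) := by
    rw [hm]
    exact hF.smul_measure ENNReal.ofReal_ne_top
  exact hF'.comp_measurable (LinearMap.continuous_on_pi _).measurable

theorem integral_comp_mulVec {R : Matrix (Fin k) (Fin k) ℝ} (hR : R.det ≠ 0)
    {F : (Fin k → ℝ) → ℝ} (hF : Integrable F) :
    ∫ x, F (R *ᵥ x) = |R.det|⁻¹ * ∫ x, F x := by
  have hm := Real.map_matrix_volume_pi_eq_smul_volume_pi hR
  have h := integral_map (μ := (volume : Measure (Fin k → ℝ))) (φ := toLin' R) (f := F)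
    (LinearMap.continuous_on_pi _).measurable.aemeasurable (by
      rw [hm]
      exact hF.aestronglyMeasurable.smul_measure _)
  simp only [toLin'_apply] at h
  rw [← h, hm, integral_smul_measure, ENNReal.toReal_ofReal (abs_nonneg _), abs_inv, smul_eq_mul]

theorem integrable_mvnPDF_mul (hS : S.PosDef) (w : Fin k → ℝ) {G : (Fin k → ℝ) → ℝ}
    (hG : Integrable (fun u => G u * ∏ i, stdPDF (u i))) :
    Integrable (fun x => mvnPDF w S⁻¹ x * G (matSqrt S *ᵥ (x - w))) := by
  have h := ((integrable_comp_mulVec (det_matSqrt_ne_zero hS) hG).comp_sub_right w).const_mul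
    |(matSqrt S).det|
  refine h.congr (.of_forall fun x => ?_)
  simp only [mvnPDF_eq_prod hS]
  ring

theorem integral_mvnPDF_mul (hS : S.PosDef) (w : Fin k → ℝ) {G : (Fin k → ℝ) → ℝ}
    (hG : Integrable (fun u => G u * ∏ i, stdPDF (u i))) :
    ∫ x, mvnPDF w S⁻¹ x * G (matSqrt S *ᵥ (x - w)) = ∫ u, G u * ∏ i, stdPDF (u i) := by
  have hd := abs_ne_zero.2 (det_matSqrt_ne_zero hS)
  have h : (fun x => mvnPDF w S⁻¹ x * G (matSqrt S *ᵥ (x - w))) = fun x =>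
      |(matSqrt S).det| * (fun y => G (matSqrt S *ᵥ y) * ∏ i, stdPDF ((matSqrt S *ᵥ y) i))
        (x - w) := by
    ext x
    simp only [mvnPDF_eq_prod hS]
    ring
  rw [h, integral_const_mul, integral_sub_right_eq_self
    (fun y => G (matSqrt S *ᵥ y) * ∏ i, stdPDF ((matSqrt S *ᵥ y) i)),
    integral_comp_mulVec (det_matSqrt_ne_zero hS) hG, mul_inv_cancel_left₀ hd]

theorem integrable_pow_mul_stdPDF (j : ℕ) : Integrable (fun t => t ^ j * stdPDF t) := by
  have h : Integrable (fun t : ℝ => t ^ j) (gaussianReal 0 1) := by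
    have := (memLp_id_gaussianReal (μ := 0) (v := 1) j).integrable_norm_pow'
    refine this.mono (by fun_prop) (.of_forall fun t => ?_)
    simp
  rw [gaussianReal_of_var_ne_zero _ one_ne_zero,
    integrable_withDensity_iff (measurable_gaussianPDF 0 1)
      (.of_forall fun _ => gaussianPDF_lt_top)] at h
  simpa [toReal_gaussianPDF, stdPDF] using h

theorem integral_mul_stdPDF : ∫ t, t * stdPDF t = 0 := by
  have h := integral_id_gaussianReal (μ := 0) (v := 1)
  rw [integral_gaussianReal_eq_integral_smul one_ne_zero] at h
  simpa [stdPDF, mul_comm] using h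

theorem integral_stdPDF : ∫ t, stdPDF t = 1 :=
  integral_gaussianPDFReal_eq_one 0 one_ne_zero

theorem integral_sq_mul_stdPDF : ∫ t, t ^ 2 * stdPDF t = 1 := by
  have h := variance_fun_id_gaussianReal (μ := 0) (v := 1)
  rw [variance_eq_integral (by fun_prop), integral_id_gaussianReal,
    integral_gaussianReal_eq_integral_smul one_ne_zero] at h
  simpa [stdPDF, mul_comm] using h

theorem mvnPDF_nonneg (w : Fin k → ℝ) (C : Matrix (Fin k) (Fin k) ℝ) (x : Fin k → ℝ) :
    0 ≤ mvnPDF w C x := by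
  unfold mvnPDF
  positivity

theorem continuous_mvnPDF (C : Matrix (Fin k) (Fin k) ℝ) :
    Continuous (fun y : (Fin k → ℝ) × (Fin k → ℝ) => mvnPDF y.1 C y.2) := by
  have h : Continuous (fun y : (Fin k → ℝ) × (Fin k → ℝ) => C⁻¹ *ᵥ (y.2 - y.1)) := by
    fun_prop
  unfold mvnPDF
  fun_prop

theorem integrable_mvnPDF (hS : S.PosDef) (w : Fin k → ℝ) : Integrable (mvnPDF w S⁻¹) := by
  have h := integrable_mvnPDF_mul hS w (G := fun _ => 1)
    (by simpa using integrable_prod_density (fun _ j => integrable_pow_mul_stdPDF j))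
  simpa using h

theorem integral_mvnPDF (hS : S.PosDef) (w : Fin k → ℝ) : ∫ x, mvnPDF w S⁻¹ x = 1 := by
  have h := integral_mvnPDF_mul hS w (G := fun _ => 1)
    (by simpa using integrable_prod_density (fun _ j => integrable_pow_mul_stdPDF j))
  simpa [integral_prod_density (fun _ => integral_stdPDF)] using h

theorem quad_eq_standardized (hS : S.PosDef) (w b x : Fin k → ℝ) :
    (x - b) ⬝ᵥ (S *ᵥ (x - b)) =
      (matSqrt S *ᵥ (x - w) - matSqrt S *ᵥ (b - w)) ⬝ᵥ
        ((1 : Matrix (Fin k) (Fin k) ℝ) *ᵥ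
          (matSqrt S *ᵥ (x - w) - matSqrt S *ᵥ (b - w))) := by
  rw [one_mulVec, ← mulVec_sub, sub_sub_sub_cancel_right, ← sqNorm_eq,
    sqNorm_matSqrt_mulVec hS.posSemidef]

theorem integrable_mvnPDF_mul_quad (hS : S.PosDef) (w b : Fin k → ℝ) :
    Integrable (fun x => mvnPDF w S⁻¹ x * ((x - b) ⬝ᵥ (S *ᵥ (x - b)))) := by
  simp_rw [quad_eq_standardized hS w b]
  exact integrable_mvnPDF_mul hS w
    (G := fun u => (u - matSqrt S *ᵥ (b - w)) ⬝ᵥ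
      ((1 : Matrix (Fin k) (Fin k) ℝ) *ᵥ (u - matSqrt S *ᵥ (b - w))))
    (integrable_quad_mul_prod (fun _ j => integrable_pow_mul_stdPDF j) _ _)

theorem integral_mvnPDF_mul_quad (hS : S.PosDef) (w b : Fin k → ℝ) :
    ∫ x, mvnPDF w S⁻¹ x * ((x - b) ⬝ᵥ (S *ᵥ (x - b))) = (w - b) ⬝ᵥ (S *ᵥ (w - b)) + k := by
  simp_rw [quad_eq_standardized hS w b]
  rw [integral_mvnPDF_mul hS w
    (G := fun u => (u - matSqrt S *ᵥ (b - w)) ⬝ᵥ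
      ((1 : Matrix (Fin k) (Fin k) ℝ) *ᵥ (u - matSqrt S *ᵥ (b - w))))
    (integrable_quad_mul_prod (fun _ j => integrable_pow_mul_stdPDF j) _ _),
    integral_quad_mul_prod (m := 0) (s := 1) (fun _ j => integrable_pow_mul_stdPDF j)
      (fun _ => integral_stdPDF) (fun _ => integral_mul_stdPDF)
      (fun _ => by simp [integral_sq_mul_stdPDF])]
  simp

/-- Lower bound of a Gaussian density by a fixed Gaussian density with half the covariance. -/
theorem le_mvnPDF (hS : S.PosDef) {w b : Fin k → ℝ} {d : ℝ}
    (hw : (w - b) ⬝ᵥ (S *ᵥ (w - b)) ≤ d) (x : Fin k → ℝ) :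
    minorEps k d * mvnPDF b ((2 : ℝ) • S)⁻¹ x ≤ mvnPDF w S⁻¹ x := by
  have h2 : ((2 : ℝ) • S).PosDef := hS.smul two_pos
  rw [mvnPDF_inv hS, mvnPDF_inv h2]
  -- Doubling the precision multiplies the normalizing constant by 2^{k/2}, which the factor
  -- 2^{-k/2} in ε compensates.
  have hd : |(matSqrt ((2 : ℝ) • S)).det| = (2 : ℝ) ^ ((k : ℝ) / 2) * |(matSqrt S).det| := by
    rw [← abs_of_pos (show (0 : ℝ) < 2 ^ ((k : ℝ) / 2) by positivity), ← abs_mul,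
      ← sq_eq_sq_iff_abs_eq_abs, mul_pow, det_matSqrt_sq h2.posSemidef,
      det_matSqrt_sq hS.posSemidef, det_smul, Fintype.card_fin, ← Real.rpow_natCast (2 ^ _),
      ← Real.rpow_mul two_pos.le]
    norm_num
  have he : minorEps k d * (2 : ℝ) ^ ((k : ℝ) / 2) = Real.exp (-d) := by
    rw [minorEps, mul_right_comm, ← Real.rpow_add two_pos]
    ring_nf
    simp
  have hexp : Real.exp (-d) * Real.exp (-(1 / 2) * ((x - b) ⬝ᵥ (((2 : ℝ) • S) *ᵥ (x - b)))) ≤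
      Real.exp (-(1 / 2) * ((x - w) ⬝ᵥ (S *ᵥ (x - w)))) := by
    rw [← Real.exp_add]
    refine Real.exp_le_exp.2 ?_
    rw [smul_mulVec, dotProduct_smul, smul_eq_mul]
    rw [← sqNorm_matSqrt_mulVec hS.posSemidef] at hw ⊢
    rw [← sqNorm_matSqrt_mulVec hS.posSemidef]
    have e : matSqrt S *ᵥ (x - w) = matSqrt S *ᵥ (x - b) - matSqrt S *ᵥ (w - b) := by
      rw [← mulVec_sub, sub_sub_sub_cancel_right]
    -- Parallelogram inequality: ‖x - w‖² ≤ 2‖x - b‖² + 2‖w - b‖² in the S-norm. The first 2 is why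
    -- the minorizing law has half the covariance; the second produces e^{-d}.
    have hsum := sqNorm_nonneg (matSqrt S *ᵥ (x - b) + matSqrt S *ᵥ (w - b))
    rw [e]
    simp only [sqNorm_eq, sub_dotProduct, dotProduct_sub, add_dotProduct, dotProduct_add]
      at hw hsum ⊢
    linarith
  calc _ = (Real.sqrt ((2 * Real.pi) ^ k))⁻¹ * |(matSqrt S).det| *
      ((minorEps k d * (2 : ℝ) ^ ((k : ℝ) / 2)) *
        Real.exp (-(1 / 2) * ((x - b) ⬝ᵥ (((2 : ℝ) • S) *ᵥ (x - b))))) := by rw [hd]; ring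
    _ ≤ _ := by
      rw [he]
      gcongr

end Gaussian

/-! ### The contraction exponent and its comparison with ρ̂ -/

section Rates

/-- A concave power lies below its tangent at t; the proof is weighted AM–GM for h and t. An affine
majorant is what a drift condition can integrate. -/
theorem rpow_le_tangent {s t h : ℝ} (hs0 : 0 ≤ s) (hs1 : s ≤ 1) (ht : 0 < t) (hh : 0 ≤ h) :
    h ^ s ≤ (1 - s) * t ^ s + s * t ^ (s - 1) * h := by
  have h1 := Real.geom_mean_le_arith_mean2_weighted hs0 (sub_nonneg.2 hs1) hh ht.le (by ring)
  have h2 : 0 < t ^ (s - 1) := by positivity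
  have h3 := mul_le_mul_of_nonneg_left h1 h2.le
  have h4 : t ^ (s - 1) * t ^ (1 - s) = 1 := by
    rw [← Real.rpow_add ht]; simp
  have h5 : t ^ (s - 1) * t = t ^ s := by
    rw [← Real.rpow_add_one ht.ne']; simp
  calc h ^ s = t ^ (s - 1) * (h ^ s * t ^ (1 - s)) := by
        rw [mul_left_comm, h4, mul_one]
    _ ≤ _ := h3
    _ = _ := by rw [← h5]; ring

theorem tangent_self {s t : ℝ} (ht : 0 < t) :
    (1 - s) * t ^ s + s * t ^ (s - 1) * t = t ^ s := by
  rw [mul_assoc, ← Real.rpow_add_one ht.ne']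
  simp only [sub_add_cancel]
  ring

/-- The contraction exponent and rate hidden behind the drift-and-minorization rate. -/
theorem exists_contraction_rate {lam L d ε r : ℝ} (hl0 : 0 ≤ lam) (hl1 : lam < 1) (hL : 1 ≤ L)
    (hd : 2 * L / (1 - lam) < d) (hε0 : 0 < ε) (hε1 : ε ≤ 1 / 2) (hr0 : 0 < r) :
    ∃ s κ : ℝ, 0 ≤ s ∧ s ≤ 1 / 2 ∧ 0 < κ ∧ ((1 + 2 * L + lam * d) / (1 + d)) ^ s ≤ κ ∧
      (1 - ε) * ((1 + 2 * (lam * d + L)) / (1 - ε)) ^ s ≤ κ ∧ κ ≤ rhoHat lam L ε d r := by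
  have hl : 0 < 1 - lam := by linarith
  have hd' : 2 * L < d * (1 - lam) := (div_lt_iff₀ hl).1 hd
  have hd0 : 0 < d := lt_trans (by positivity) hd
  set a := 1 - ε with ha
  set v := (1 + 2 * L + lam * d) / (1 + d) with hv
  set A := 1 + 2 * (lam * d + L) with hA
  have ha0 : 0 < a := by linarith
  have ha1 : a < 1 := by linarith
  have hld : 0 ≤ lam * d := by positivity
  have hv0 : 0 < v := by positivity
  have hv1 : v < 1 := by
    rw [hv, div_lt_one (by linarith)]
    linarith
  have hA3 : 3 ≤ A := by rw [hA]; linarith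
  have hA0 : 0 < A := by linarith
  have hla : Real.log a < 0 := Real.log_neg ha0 ha1
  have hlv : Real.log v < 0 := Real.log_neg hv0 hv1
  -- This is the condition s ≤ 1/2 in disguise; it holds because A ≥ 3 and a ≥ 1/2 give Aa ≥ 1,
  -- while v < 1.
  have hkey : 0 ≤ Real.log A + Real.log a - Real.log v := by
    have h1 : 0 ≤ Real.log (A * a) := Real.log_nonneg (by nlinarith)
    rw [Real.log_mul hA0.ne' ha0.ne'] at h1
    linarith
  set lc := Real.log A - Real.log a - Real.log v with hlc
  have hlc0 : 0 < lc := by linarith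
  -- The exponent that equalizes the two requirements: v^s = a (A/a)^s.
  set s := -Real.log a / lc with hs
  have hsl : s * lc = -Real.log a := by rw [hs]; field_simp
  have hs0 : 0 ≤ s := div_nonneg (by linarith) hlc0.le
  have hs2 : s ≤ 1 / 2 := by
    rw [hs, div_le_iff₀ hlc0]
    linarith
  refine ⟨s, v ^ s, hs0, hs2, by positivity, le_rfl, le_of_eq ?_, ?_⟩
  · rw [Real.rpow_def_of_pos (by positivity), Real.rpow_def_of_pos hv0,
      Real.log_div hA0.ne' ha0.ne']
    nth_rewrite 1 [← Real.exp_log ha0]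
    rw [← Real.exp_add]
    congr 1
    linear_combination hsl - s * hlc
  · rw [rhoHat, ← ha, ← hv, ← hA]
    rw [Real.rpow_def_of_pos ha0, Real.rpow_def_of_pos hv0, Real.rpow_def_of_pos hv0,
      Real.rpow_def_of_pos hA0, ← Real.exp_add]
    -- As r grows, a^r decreases and v^{1-r} A^r increases; they cross at r · lc = -log v, with
    -- common value v^s = κ. On either side of the crossing the larger term is at least κ.
    rcases le_total (r * lc) (-Real.log v) with h | h
    · refine le_max_of_le_left (Real.exp_le_exp.2 ?_)
      have : Real.log a = -(s * lc) := by linarith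
      rw [this]
      nlinarith
    · refine le_max_of_le_right (Real.exp_le_exp.2 ?_)
      have h1 : 0 ≤ (Real.log v + r * lc) * (1 - s) :=
        mul_nonneg (by linarith) (by linarith)
      nlinarith

end Rates

/-! ### Markov densities and their integral operators -/

section MarkovDensity

variable {E F G : Type*} [MeasurableSpace E] [MeasurableSpace F] [MeasurableSpace G]

/-- A jointly measurable family of probability densities. -/
structure IsMarkovDensity (μ : Measure F) (k : E → F → ℝ) : Prop where
  measurable : Measurable (Function.uncurry k)
  nonneg : ∀ x y, 0 ≤ k x y
  integrable : ∀ x, Integrable (k x) μ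
  integral_eq_one : ∀ x, ∫ y, k x y ∂μ = 1

/-- The integral operator of a Markov density. -/
def densOp (μ : Measure F) (k : E → F → ℝ) (f : F → ℝ) (x : E) : ℝ := ∫ y, k x y * f y ∂μ

theorem integrable_mul_of_abs_le {μ : Measure F} {ρ f : F → ℝ} {C : ℝ} (hρ : Integrable ρ μ)
    (hf : Measurable f) (hC : ∀ y, |f y| ≤ C) : Integrable (fun y => ρ y * f y) μ :=
  hρ.mul_bdd hf.aestronglyMeasurable (.of_forall hC)

variable {μ : Measure F} {k : E → F → ℝ}

theorem IsMarkovDensity.integrable_mul (hk : IsMarkovDensity μ k) (x : E) {f : F → ℝ} {C : ℝ}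
    (hf : Measurable f) (hC : ∀ y, |f y| ≤ C) : Integrable (fun y => k x y * f y) μ :=
  integrable_mul_of_abs_le (hk.integrable x) hf hC

theorem IsMarkovDensity.measurable_densOp [SFinite μ] (hk : IsMarkovDensity μ k) {f : F → ℝ}
    (hf : Measurable f) : Measurable (densOp μ k f) := by
  have h : Measurable (fun p : E × F => k p.1 p.2 * f p.2) :=
    hk.measurable.mul (hf.comp measurable_snd)
  exact h.stronglyMeasurable.integral_prod_right'.measurable

theorem IsMarkovDensity.densOp_mono (hk : IsMarkovDensity μ k) {f g : F → ℝ} {x : E}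
    (hf : Integrable (fun y => k x y * f y) μ) (hg : Integrable (fun y => k x y * g y) μ)
    (h : ∀ y, f y ≤ g y) : densOp μ k f x ≤ densOp μ k g x :=
  integral_mono hf hg fun y => mul_le_mul_of_nonneg_left (h y) (hk.nonneg x y)

theorem IsMarkovDensity.densOp_const (hk : IsMarkovDensity μ k) (c : ℝ) (x : E) :
    densOp μ k (fun _ => c) x = c := by
  simp [densOp, integral_mul_const, hk.integral_eq_one]

theorem IsMarkovDensity.abs_densOp_le (hk : IsMarkovDensity μ k) {f : F → ℝ} {C : ℝ}
    (hf : Measurable f) (hC : ∀ y, |f y| ≤ C) (x : E) : |densOp μ k f x| ≤ C := by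
  have hfi := hk.integrable_mul x hf hC
  refine abs_le.2 ⟨?_, ?_⟩
  · rw [← hk.densOp_const (-C) x]
    exact hk.densOp_mono ((hk.integrable x).mul_const _) hfi fun y => (abs_le.1 (hC y)).1
  · rw [← hk.densOp_const C x]
    exact hk.densOp_mono hfi ((hk.integrable x).mul_const _) fun y => (abs_le.1 (hC y)).2

theorem IsMarkovDensity.integrable_affine (hk : IsMarkovDensity μ k) {f : F → ℝ} {x : E}
    (hf : Integrable (fun y => k x y * f y) μ) (p r : ℝ) :
    Integrable (fun y => k x y * (p * f y + r)) μ := by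
  simp_rw [mul_add, mul_left_comm _ p]
  exact (hf.const_mul p).add ((hk.integrable x).mul_const r)

theorem IsMarkovDensity.densOp_affine (hk : IsMarkovDensity μ k) {f : F → ℝ} {x : E}
    (hf : Integrable (fun y => k x y * f y) μ) (p r : ℝ) :
    densOp μ k (fun y => p * f y + r) x = p * densOp μ k f x + r := by
  simp only [densOp, mul_add, mul_left_comm _ p]
  rw [integral_add (hf.const_mul p) ((hk.integrable x).mul_const r),
    integral_const_mul, integral_mul_const, hk.integral_eq_one, one_mul]

/-- The composition of two densities. -/
def compDensity (μ : Measure F) (k : E → F → ℝ) (l : F → G → ℝ) (x : E) (z : G) : ℝ :=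
  ∫ y, k x y * l y z ∂μ

variable {ν : Measure G} {l : F → G → ℝ}

theorem IsMarkovDensity.measurable_comp_integrand (hk : IsMarkovDensity μ k)
    (hl : IsMarkovDensity ν l) :
    Measurable (fun p : (E × G) × F => k p.1.1 p.2 * l p.2 p.1.2) :=
  (hk.measurable.comp (by fun_prop : Measurable fun p : (E × G) × F => (p.1.1, p.2))).mul
    (hl.measurable.comp (by fun_prop : Measurable fun p : (E × G) × F => (p.2, p.1.2)))

theorem IsMarkovDensity.integrable_comp_integrand [SFinite μ] [SFinite ν]
    (hk : IsMarkovDensity μ k) (hl : IsMarkovDensity ν l) (x : E) {g : G → ℝ} {C : ℝ}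
    (hg : Measurable g) (hC : ∀ z, |g z| ≤ C) :
    Integrable (fun p : F × G => k x p.1 * l p.1 p.2 * g p.2) (μ.prod ν) := by
  have hm : Measurable (fun p : F × G => k x p.1 * l p.1 p.2 * g p.2) :=
    ((hk.measurable.comp (by fun_prop : Measurable fun p : F × G => (x, p.1))).mul
      hl.measurable).mul (hg.comp measurable_snd)
  rw [integrable_prod_iff hm.aestronglyMeasurable]
  refine ⟨.of_forall fun y => ?_, ?_⟩
  · simp_rw [mul_assoc]
    exact (hl.integrable_mul y hg hC).const_mul _
  · have he : (fun y => ∫ z, ‖k x y * l y z * g z‖ ∂ν) =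
        fun y => k x y * densOp ν l (fun z => |g z|) y := by
      ext y
      rw [densOp, ← integral_const_mul]
      refine integral_congr_ae (.of_forall fun z => ?_)
      simp only [Real.norm_eq_abs, abs_mul, abs_of_nonneg (hk.nonneg x y),
        abs_of_nonneg (hl.nonneg y z), mul_assoc]
    rw [he]
    have hg' : Measurable fun z => |g z| := hg.abs
    exact hk.integrable_mul x (hl.measurable_densOp hg')
      (hl.abs_densOp_le hg' (C := C) fun z => by simpa using hC z)

theorem IsMarkovDensity.densOp_comp [SFinite μ] [SFinite ν] (hk : IsMarkovDensity μ k)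
    (hl : IsMarkovDensity ν l) {g : G → ℝ} {C : ℝ} (hg : Measurable g) (hC : ∀ z, |g z| ≤ C)
    (x : E) : densOp ν (compDensity μ k l) g x = densOp μ k (densOp ν l g) x := by
  have h := integral_integral_swap (f := fun y z => k x y * l y z * g z)
    (hk.integrable_comp_integrand hl x hg hC)
  simp only [densOp, compDensity]
  simp_rw [← integral_mul_const, ← integral_const_mul, ← mul_assoc]
  exact h.symm

theorem IsMarkovDensity.comp [SFinite μ] [SFinite ν] (hk : IsMarkovDensity μ k)
    (hl : IsMarkovDensity ν l) : IsMarkovDensity ν (compDensity μ k l) where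
  measurable := (hk.measurable_comp_integrand hl).stronglyMeasurable.integral_prod_right'.measurable
  nonneg x z := integral_nonneg fun y => mul_nonneg (hk.nonneg x y) (hl.nonneg y z)
  integrable x := by
    have h := hk.integrable_comp_integrand hl x (g := fun _ => 1) (C := 1) measurable_const
      (by simp)
    have h2 := h.integral_prod_right
    simp only [mul_one] at h2
    exact h2
  integral_eq_one x := by
    have h := hk.densOp_comp hl (g := fun _ => 1) (C := 1) measurable_const (by simp) x
    have h1 : densOp ν l (fun _ => 1) = fun _ => 1 := funext fun y => hl.densOp_const 1 y
    rw [h1, hk.densOp_const] at h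
    simpa [densOp] using h

/-- Integrate the pointwise inequality against the product ρ₁ ⊗ ρ₂ and divide by the mass a. The two
variables are integrated one after the other, so no product measure is needed. -/
theorem integral_sub_integral_le {ρ₁ ρ₂ f W : F → ℝ} {a A B : ℝ} (ha : 0 < a)
    (h₁ : ∀ y, 0 ≤ ρ₁ y) (h₂ : ∀ y, 0 ≤ ρ₂ y) (i₁ : Integrable ρ₁ μ) (i₂ : Integrable ρ₂ μ)
    (f₁ : Integrable (fun y => ρ₁ y * f y) μ) (f₂ : Integrable (fun y => ρ₂ y * f y) μ)
    (w₁ : Integrable (fun y => ρ₁ y * W y) μ) (w₂ : Integrable (fun y => ρ₂ y * W y) μ)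
    (m₁ : ∫ y, ρ₁ y ∂μ = a) (m₂ : ∫ y, ρ₂ y ∂μ = a)
    (hf : ∀ x y, f x - f y ≤ A + B * (W x + W y)) :
    ∫ y, ρ₁ y * f y ∂μ - ∫ y, ρ₂ y * f y ∂μ ≤
      a * A + B * (∫ y, ρ₁ y * W y ∂μ + ∫ y, ρ₂ y * W y ∂μ) := by
  have s1 : ∀ y, ∫ x, ρ₁ x * f x ∂μ ≤ a * (A + B * W y + f y) + B * ∫ x, ρ₁ x * W x ∂μ := by
    intro y
    have e : a * (A + B * W y + f y) + B * ∫ x, ρ₁ x * W x ∂μ =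
        ∫ x, (ρ₁ x * (A + B * W y + f y) + B * (ρ₁ x * W x)) ∂μ := by
      rw [integral_add (i₁.mul_const _) (w₁.const_mul _), integral_mul_const, m₁,
        integral_const_mul]
    rw [e]
    refine integral_mono f₁ ((i₁.mul_const _).add (w₁.const_mul _)) fun x => ?_
    have := mul_le_mul_of_nonneg_left (hf x y) (h₁ x)
    simp only
    linarith
  set I₁ := ∫ x, ρ₁ x * f x ∂μ
  set J₁ := ∫ x, ρ₁ x * W x ∂μ
  have s2 : a * I₁ ≤ ∫ y, ((ρ₂ y * (a * A + B * J₁) + a * B * (ρ₂ y * W y)) +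
      a * (ρ₂ y * f y)) ∂μ := by
    rw [← m₂, ← integral_mul_const, m₂]
    refine integral_mono (i₂.mul_const _)
      (((i₂.mul_const _).add (w₂.const_mul _)).add (f₂.const_mul _)) fun y => ?_
    have := mul_le_mul_of_nonneg_left (s1 y) (h₂ y)
    simp only
    linarith
  have e2 : ∫ y, ((ρ₂ y * (a * A + B * J₁) + a * B * (ρ₂ y * W y)) + a * (ρ₂ y * f y)) ∂μ =
      (a * (a * A + B * J₁) + a * B * ∫ y, ρ₂ y * W y ∂μ) + a * ∫ y, ρ₂ y * f y ∂μ := by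
    rw [integral_add ?_ (f₂.const_mul _), integral_add (i₂.mul_const _) (w₂.const_mul _),
      integral_mul_const, m₂, integral_const_mul, integral_const_mul]
    exact (i₂.mul_const _).add (w₂.const_mul _)
  rw [e2] at s2
  refine le_of_mul_le_mul_left ?_ ha
  linarith

end MarkovDensity

/-! ### Geometric convergence from drift and minorization -/

section Convergence

variable {E G : Type*} [MeasurableSpace E] [MeasurableSpace G] {μ : Measure E} {ν : Measure G}

/-- A two-stage Markov chain `G → E → G` with a drift condition and a minorization condition. -/
structure DriftMinorization (μ : Measure E) (ν : Measure G) (S : G → E → ℝ) (T : E → G → ℝ)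
    (V : G → ℝ) (ψ : E → ℝ) (lam L d ε : ℝ) : Prop where
  densS : IsMarkovDensity μ S
  densT : IsMarkovDensity ν T
  measV : Measurable V
  nonnegV : ∀ z, 0 ≤ V z
  integrableT : ∀ b, Integrable (fun z => T b z * V z) ν
  integrableS : ∀ z, Integrable (fun b => S z b * densOp ν T V b) μ
  drift : ∀ z, densOp μ S (densOp ν T V) z ≤ lam * V z + L
  integrableψ : Integrable ψ μ
  nonnegψ : ∀ b, 0 ≤ ψ b
  integralψ : ∫ b, ψ b ∂μ = ε
  measψ : Measurable ψ
  minor : ∀ z, V z ≤ d → ∀ b, ψ b ≤ S z b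

variable {S : G → E → ℝ} {T : E → G → ℝ} {V : G → ℝ} {ψ : E → ℝ} {lam L d ε : ℝ}

theorem DriftMinorization.nonneg_densOp (h : DriftMinorization μ ν S T V ψ lam L d ε) (b : E) :
    0 ≤ densOp ν T V b :=
  integral_nonneg fun z => mul_nonneg (h.densT.nonneg b z) (h.nonnegV z)

theorem DriftMinorization.densOp_sub_le (h : DriftMinorization μ ν S T V ψ lam L d ε)
    {q : G → ℝ} {C A B : ℝ} (hq : Measurable q) (hC : ∀ z, |q z| ≤ C)
    (hAB : ∀ z z', q z - q z' ≤ A + B * (V z + V z')) (b b' : E) :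
    densOp ν T q b - densOp ν T q b' ≤ A + B * (densOp ν T V b + densOp ν T V b') := by
  have := integral_sub_integral_le (μ := ν) one_pos (h.densT.nonneg b) (h.densT.nonneg b')
    (h.densT.integrable b) (h.densT.integrable b') (h.densT.integrable_mul b hq hC)
    (h.densT.integrable_mul b' hq hC) (h.integrableT b) (h.integrableT b')
    (h.densT.integral_eq_one b) (h.densT.integral_eq_one b') hAB
  simpa [densOp] using this

variable [SFinite ν]

theorem DriftMinorization.comp_sub_le (h : DriftMinorization μ ν S T V ψ lam L d ε)
    {q : G → ℝ} {C A B : ℝ} (hB : 0 ≤ B) (hq : Measurable q) (hC : ∀ z, |q z| ≤ C)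
    (hAB : ∀ z z', q z - q z' ≤ A + B * (V z + V z')) (z z' : G) :
    densOp μ S (densOp ν T q) z - densOp μ S (densOp ν T q) z' ≤
      A + B * (lam * (V z + V z') + 2 * L) := by
  have hm := h.densT.measurable_densOp hq
  have hb := h.densT.abs_densOp_le hq hC
  have := integral_sub_integral_le (μ := μ) one_pos (h.densS.nonneg z) (h.densS.nonneg z')
    (h.densS.integrable z) (h.densS.integrable z') (h.densS.integrable_mul z hm hb)
    (h.densS.integrable_mul z' hm hb) (h.integrableS z) (h.integrableS z')
    (h.densS.integral_eq_one z) (h.densS.integral_eq_one z') (h.densOp_sub_le hq hC hAB)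
  have d1 := h.drift z
  have d2 := h.drift z'
  rw [one_mul] at this
  refine this.trans ?_
  have h3 : densOp μ S (densOp ν T V) z + densOp μ S (densOp ν T V) z' ≤
      lam * (V z + V z') + 2 * L := by linarith
  have := mul_le_mul_of_nonneg_left h3 hB
  simp only [densOp] at this ⊢
  linarith

/-- The common part ψ cancels in the difference, leaving two residual densities of mass 1 - ε. This
shrinks the constant term, while removing ψ can only lower the drift terms. -/
theorem DriftMinorization.comp_sub_le_of_small (h : DriftMinorization μ ν S T V ψ lam L d ε)
    (hε : ε < 1) {q : G → ℝ} {C A B : ℝ} (hB : 0 ≤ B) (hq : Measurable q)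
    (hC : ∀ z, |q z| ≤ C) (hAB : ∀ z z', q z - q z' ≤ A + B * (V z + V z')) {z z' : G}
    (hz : V z ≤ d) (hz' : V z' ≤ d) :
    densOp μ S (densOp ν T q) z - densOp μ S (densOp ν T q) z' ≤
      (1 - ε) * A + B * (lam * (V z + V z') + 2 * L) := by
  have hm := h.densT.measurable_densOp hq
  have hb := h.densT.abs_densOp_le hq hC
  have hW := h.nonneg_densOp
  have hψf := integrable_mul_of_abs_le h.integrableψ hm hb
  have hψW : ∀ z, V z ≤ d → Integrable (fun b => ψ b * densOp ν T V b) μ := fun z hz =>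
    (h.integrableS z).mono'
      (h.measψ.mul (h.densT.measurable_densOp h.measV)).aestronglyMeasurable
      (.of_forall fun b => by
        rw [Real.norm_of_nonneg (mul_nonneg (h.nonnegψ b) (hW b))]
        exact mul_le_mul_of_nonneg_right (h.minor z hz b) (hW b))
  have hres : ∀ z, V z ≤ d → ∀ f : E → ℝ, Integrable (fun b => S z b * f b) μ →
      Integrable (fun b => ψ b * f b) μ → Integrable (fun b => (S z b - ψ b) * f b) μ ∧
        ∫ b, (S z b - ψ b) * f b ∂μ = ∫ b, S z b * f b ∂μ - ∫ b, ψ b * f b ∂μ := by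
    intro z _ f h1 h2
    simp_rw [sub_mul]
    exact ⟨h1.sub h2, integral_sub h1 h2⟩
  have hmass : ∀ z, ∫ b, (S z b - ψ b) ∂μ = 1 - ε := fun z => by
    rw [integral_sub (h.densS.integrable z) h.integrableψ, h.densS.integral_eq_one, h.integralψ]
  have r1 := hres z hz _ (h.densS.integrable_mul z hm hb) hψf
  have r2 := hres z' hz' _ (h.densS.integrable_mul z' hm hb) hψf
  have w1 := hres z hz _ (h.integrableS z) (hψW z hz)
  have w2 := hres z' hz' _ (h.integrableS z') (hψW z hz)
  have := integral_sub_integral_le (μ := μ) (sub_pos.2 hε)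
    (fun b => sub_nonneg.2 (h.minor z hz b)) (fun b => sub_nonneg.2 (h.minor z' hz' b))
    ((h.densS.integrable z).sub h.integrableψ) ((h.densS.integrable z').sub h.integrableψ)
    r1.1 r2.1 w1.1 w2.1 (hmass z) (hmass z') (h.densOp_sub_le hq hC hAB)
  rw [r1.2, r2.2, w1.2, w2.2] at this
  have hψ0 : 0 ≤ ∫ b, ψ b * densOp ν T V b ∂μ :=
    integral_nonneg fun b => mul_nonneg (h.nonnegψ b) (hW b)
  have d1 := h.drift z
  have d2 := h.drift z'
  have h3 : ∫ b, S z b * densOp ν T V b ∂μ - ∫ b, ψ b * densOp ν T V b ∂μ +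
      (∫ b, S z' b * densOp ν T V b ∂μ - ∫ b, ψ b * densOp ν T V b ∂μ) ≤
      lam * (V z + V z') + 2 * L := by
    rw [densOp] at d1 d2
    linarith
  have := mul_le_mul_of_nonneg_left h3 hB
  rw [densOp, densOp]
  linarith

variable {s κ : ℝ}

/-- The power modulus is replaced by its tangent at a point t suited to the pair, and the averaged
affine bound is evaluated back on the tangent. If both points are small, minorization supplies the
gain; otherwise V(z) + V(z') ≥ d and the drift alone does. -/
theorem DriftMinorization.contraction_step (h : DriftMinorization μ ν S T V ψ lam L d ε)
    (hl0 : 0 ≤ lam) (hl1 : lam < 1) (hL : 1 ≤ L) (hd : 0 < d)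
    (hε0 : 0 ≤ ε) (hε : ε < 1) (hs0 : 0 ≤ s) (hs1 : s ≤ 1)
    (hout : ((1 + 2 * L + lam * d) / (1 + d)) ^ s ≤ κ)
    (hin : (1 - ε) * ((1 + 2 * (lam * d + L)) / (1 - ε)) ^ s ≤ κ)
    {q : G → ℝ} {C c : ℝ} (hc : 0 ≤ c) (hq : Measurable q) (hC : ∀ z, |q z| ≤ C)
    (hqc : ∀ z z', q z - q z' ≤ c * (1 + V z + V z') ^ s) (z z' : G) :
    densOp μ S (densOp ν T q) z - densOp μ S (densOp ν T q) z' ≤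
      c * κ * (1 + V z + V z') ^ s := by
  have hV := h.nonnegV
  have hlin : ∀ t : ℝ, 0 < t → ∀ x y, q x - q y ≤
      c * ((1 - s) * t ^ s + s * t ^ (s - 1)) + c * (s * t ^ (s - 1)) * (V x + V y) := by
    intro t ht x y
    have h1 := rpow_le_tangent hs0 hs1 ht
      (show 0 ≤ 1 + V x + V y by linarith [hV x, hV y])
    refine (hqc x y).trans ((mul_le_mul_of_nonneg_left h1 hc).trans (le_of_eq ?_))
    ring
  have hone : 1 ≤ 1 + V z + V z' := by linarith [hV z, hV z']
  have hld : 0 ≤ lam * d := by positivity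
  by_cases hsmall : V z ≤ d ∧ V z' ≤ d
  · have ha : 0 < 1 - ε := by linarith
    set A := 1 + 2 * (lam * d + L) with hA
    -- With this t one has A = (1 - ε)t, so the averaged tangent bound collapses to (1 - ε)t^s.
    set t := A / (1 - ε) with htd
    have ht : 0 < t := by positivity
    have hB : 0 ≤ c * (s * t ^ (s - 1)) := by positivity
    have key := h.comp_sub_le_of_small hε hB hq hC (hlin t ht) hsmall.1 hsmall.2
    have h2 : lam * (V z + V z') + 2 * L + (1 - ε) ≤ A := by
      have := mul_le_mul_of_nonneg_left hsmall.1 hl0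
      have := mul_le_mul_of_nonneg_left hsmall.2 hl0
      rw [hA]; linarith
    have h3 := mul_le_mul_of_nonneg_left h2 hB
    have hAt : A = (1 - ε) * t := by rw [htd]; field_simp
    have h4 : (1 - ε) * (c * ((1 - s) * t ^ s)) + c * (s * t ^ (s - 1)) * A =
        c * ((1 - ε) * t ^ s) := by
      have := tangent_self (s := s) ht
      linear_combination (c * (s * t ^ (s - 1))) * hAt + (c * (1 - ε)) * this
    calc _ ≤ c * ((1 - ε) * t ^ s) := by linarith
      _ ≤ c * κ := by gcongr
      _ ≤ c * κ * (1 + V z + V z') ^ s := by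
        have hκ : 0 ≤ κ := le_trans (by positivity) hin
        exact le_mul_of_one_le_right (by positivity) (Real.one_le_rpow hone hs0)
  · set H := 1 + V z + V z' with hH
    have hbig : d ≤ V z + V z' := by
      rw [not_and_or] at hsmall
      rcases hsmall with h1 | h1 <;> linarith [hV z, hV z']
    set t := (1 + 2 * L + lam * d) / (1 + d) * H with htd
    have hv0 : 0 < (1 + 2 * L + lam * d) / (1 + d) := by positivity
    have ht : 0 < t := by positivity
    have hB : 0 ≤ c * (s * t ^ (s - 1)) := by positivity
    have key := h.comp_sub_le hB hq hC (hlin t ht) z z'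
    -- The ratio (1 + 2L + λu)/(1 + u) decreases in u = V(z) + V(z'), so its value at d dominates.
    have h2 : 1 + (lam * (V z + V z') + 2 * L) ≤ t := by
      rw [htd, div_mul_eq_mul_div, le_div_iff₀ (by linarith), hH]
      nlinarith [mul_nonneg (sub_nonneg.2 hbig) (by linarith : 0 ≤ 1 + 2 * L - lam)]
    have h3 := mul_le_mul_of_nonneg_left h2 hB
    have h4 := tangent_self (s := s) ht
    calc _ ≤ c * ((1 - s) * t ^ s) + c * (s * t ^ (s - 1)) * t := by linarith
      _ = c * t ^ s := by linear_combination c * h4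
      _ = c * (((1 + 2 * L + lam * d) / (1 + d)) ^ s * H ^ s) := by
        rw [htd, Real.mul_rpow hv0.le (by linarith)]
      _ ≤ c * (κ * H ^ s) := by gcongr
      _ = _ := by ring

/-- The operator of the chain on `G`. -/
def pairOp (μ : Measure E) (ν : Measure G) (S : G → E → ℝ) (T : E → G → ℝ) (q : G → ℝ) : G → ℝ :=
  densOp μ S (densOp ν T q)

variable [SFinite μ]

theorem DriftMinorization.iterate_regular (h : DriftMinorization μ ν S T V ψ lam L d ε)
    {f : G → ℝ} {C : ℝ} (hf : Measurable f) (hC : ∀ z, |f z| ≤ C) (M : ℕ) :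
    Measurable ((pairOp μ ν S T)^[M] f) ∧ ∀ z, |(pairOp μ ν S T)^[M] f z| ≤ C := by
  induction M with
  | zero => exact ⟨hf, hC⟩
  | succ M ih =>
    rw [Function.iterate_succ_apply']
    have hm := h.densT.measurable_densOp ih.1
    exact ⟨h.densS.measurable_densOp hm,
      h.densS.abs_densOp_le hm (h.densT.abs_densOp_le ih.1 ih.2)⟩

/-- A function bounded by 1 oscillates by at most 2, which starts the induction with c = 2. Since s
≤ 1/2, the final modulus 2h^s with h = 1 + V(z) + V(z') is at most 2√h ≤ 1 + h. -/
theorem DriftMinorization.iterate_contraction (h : DriftMinorization μ ν S T V ψ lam L d ε)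
    (hl0 : 0 ≤ lam) (hl1 : lam < 1) (hL : 1 ≤ L) (hd : 0 < d)
    (hε0 : 0 ≤ ε) (hε : ε < 1) (hs0 : 0 ≤ s) (hs1 : s ≤ 1 / 2) (hκ : 0 ≤ κ)
    (hout : ((1 + 2 * L + lam * d) / (1 + d)) ^ s ≤ κ)
    (hin : (1 - ε) * ((1 + 2 * (lam * d + L)) / (1 - ε)) ^ s ≤ κ)
    {f : G → ℝ} (hf : Measurable f) (hC : ∀ z, |f z| ≤ 1) (M : ℕ) (z z' : G) :
    (pairOp μ ν S T)^[M] f z - (pairOp μ ν S T)^[M] f z' ≤ κ ^ M * (2 + V z + V z') := by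
  have hone : ∀ z z', 1 ≤ 1 + V z + V z' := fun z z' => by
    linarith [h.nonnegV z, h.nonnegV z']
  have hmain : ∀ M : ℕ, ∀ z z', (pairOp μ ν S T)^[M] f z - (pairOp μ ν S T)^[M] f z' ≤
      2 * κ ^ M * (1 + V z + V z') ^ s := by
    intro M
    induction M with
    | zero =>
      intro z z'
      have h1 := Real.one_le_rpow (hone z z') hs0
      have := abs_le.1 (hC z)
      have := abs_le.1 (hC z')
      simp only [Function.iterate_zero, id_eq, pow_zero, mul_one]
      linarith
    | succ M ih =>
      intro z z'
      have hr := h.iterate_regular hf hC M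
      have := h.contraction_step hl0 hl1 hL hd hε0 hε hs0 (by linarith) hout hin
        (by positivity) hr.1 hr.2 ih z z'
      rw [Function.iterate_succ_apply', pow_succ]
      refine this.trans (le_of_eq ?_)
      ring
  refine (hmain M z z').trans ?_
  have h1 : (1 + V z + V z') ^ s ≤ (1 + V z + V z') ^ (1 / 2 : ℝ) :=
    Real.rpow_le_rpow_of_exponent_le (hone z z') hs1
  have h2 := rpow_le_tangent (s := 1 / 2) (t := 1) (by norm_num) (by norm_num) one_pos
    (zero_le_one.trans (hone z z'))
  simp only [Real.one_rpow, mul_one] at h2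
  have h3 : 2 * (1 + V z + V z') ^ s ≤ 2 + V z + V z' := by linarith
  calc _ = κ ^ M * (2 * (1 + V z + V z') ^ s) := by ring
    _ ≤ _ := by gcongr

/-- Truncated moment bound for a stationary density of a chain with a drift condition. -/
theorem DriftMinorization.integral_min_le (h : DriftMinorization μ ν S T V ψ lam L d ε)
    (hl0 : 0 ≤ lam) (hl1 : lam < 1) (hL : 0 ≤ L) {π : E → ℝ} (hπ0 : ∀ b, 0 ≤ π b)
    (hπi : Integrable π μ) (hπ1 : ∫ b, π b ∂μ = 1)
    (hstat : ∀ f : E → ℝ, Measurable f → (∃ C, ∀ b, |f b| ≤ C) →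
      ∫ b, π b * densOp ν T (densOp μ S f) b ∂μ = ∫ b, π b * f b ∂μ) {c : ℝ} (hc : 0 ≤ c) :
    ∫ b, π b * min (densOp ν T V b) c ∂μ ≤ L / (1 - lam) := by
  set W := densOp ν T V with hWdef
  have hWm : Measurable W := h.densT.measurable_densOp h.measV
  have hW0 : ∀ b, 0 ≤ W b := h.nonneg_densOp
  have hl : 0 < 1 - lam := by linarith
  set B := L / (1 - lam) with hB
  have hB0 : 0 ≤ B := by positivity
  -- B is the fixed point of x ↦ λx + L, so iterating the drift sends pW + r towards the constant B.
  have hBe : lam * B + L = B := by rw [hB]; field_simp; ring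
  have hfm : ∀ p r : ℝ, Measurable fun b => min (p * W b + r) c := fun p r => by fun_prop
  have hfb : ∀ p r : ℝ, 0 ≤ p → 0 ≤ r → ∀ b, |min (p * W b + r) c| ≤ c := fun p r hp hr b => by
    have := mul_nonneg hp (hW0 b)
    rw [abs_of_nonneg (le_min (by linarith) hc)]
    exact min_le_right _ _
  -- Stationarity inserts one step of the chain, and the mean of a minimum is at most the minimum of
  -- the means. Truncating at c keeps every integral finite without assuming that W is π-integrable.
  have hstep : ∀ p r : ℝ, 0 ≤ p → 0 ≤ r → ∫ b, π b * min (p * W b + r) c ∂μ ≤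
      ∫ b, π b * min (p * lam * W b + (p * L + r)) c ∂μ := by
    intro p r hp hr
    rw [← hstat _ (hfm p r) ⟨c, hfb p r hp hr⟩]
    have hSm := h.densS.measurable_densOp (hfm p r)
    have hSb := h.densS.abs_densOp_le (hfm p r) (hfb p r hp hr)
    refine integral_mono (integrable_mul_of_abs_le hπi (h.densT.measurable_densOp hSm)
      (h.densT.abs_densOp_le hSm hSb)) (integrable_mul_of_abs_le hπi (hfm _ _)
      (hfb _ _ (by positivity) (by positivity))) fun b => ?_
    refine mul_le_mul_of_nonneg_left (le_min ?_ ?_) (hπ0 b)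
    · have hS : ∀ z, densOp μ S (fun b => min (p * W b + r) c) z ≤
          p * (lam * V z + L) + r := by
        intro z
        have hi := h.densS.integrable_affine (h.integrableS z) p r
        have h1 := h.densS.densOp_mono (h.densS.integrable_mul z (hfm p r) (hfb p r hp hr)) hi
          (fun b => min_le_left _ _)
        rw [h.densS.densOp_affine (h.integrableS z)] at h1
        have h3 := mul_le_mul_of_nonneg_left (h.drift z) hp
        linarith
      have hi := h.densT.integrable_affine (h.integrableT b) (p * lam) (p * L + r)
      have h1 := h.densT.densOp_mono (h.densT.integrable_mul b hSm hSb) hi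
        (fun z => (hS z).trans (le_of_eq (by ring)))
      rwa [h.densT.densOp_affine (h.integrableT b)] at h1
    · exact (le_abs_self _).trans (h.densT.abs_densOp_le hSm hSb b)
  have hiter : ∀ N : ℕ, ∫ b, π b * min (W b) c ∂μ ≤
      ∫ b, π b * min (lam ^ N * W b + (1 - lam ^ N) * B) c ∂μ := by
    intro N
    induction N with
    | zero => simp
    | succ N ih =>
      have hp : 0 ≤ lam ^ N := by positivity
      have hp1 : lam ^ N ≤ 1 := pow_le_one₀ hl0 hl1.le
      refine ih.trans ((hstep _ _ hp (mul_nonneg (by linarith) hB0)).trans (le_of_eq ?_))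
      have : lam ^ N * L + (1 - lam ^ N) * B = (1 - lam ^ (N + 1)) * B := by
        rw [pow_succ]
        linear_combination lam ^ N * hBe
      rw [this, pow_succ]
  have hlim : Filter.Tendsto
      (fun N : ℕ => ∫ b, π b * min (lam ^ N * W b + (1 - lam ^ N) * B) c ∂μ) Filter.atTop
      (nhds (∫ b, π b * min (0 * W b + (1 - 0) * B) c ∂μ)) := by
    refine tendsto_integral_of_dominated_convergence (fun b => π b * c) (fun N => ?_)
      (hπi.mul_const c) (fun N => .of_forall fun b => ?_) (.of_forall fun b => ?_)
    · exact hπi.aestronglyMeasurable.mul (hfm _ _).aestronglyMeasurable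
    · rw [norm_mul, Real.norm_of_nonneg (hπ0 b)]
      exact mul_le_mul_of_nonneg_left (hfb _ _ (by positivity)
        (mul_nonneg (sub_nonneg.2 (pow_le_one₀ hl0 hl1.le)) hB0) b) (hπ0 b)
    · have := tendsto_pow_atTop_nhds_zero_of_lt_one hl0 hl1
      exact Filter.Tendsto.const_mul _ (Filter.Tendsto.min
        ((this.mul_const _).add ((this.const_sub 1).mul_const _)) tendsto_const_nhds)
  refine (ge_of_tendsto' hlim hiter).trans ?_
  simp only [zero_mul, zero_add, sub_zero, one_mul]
  rw [integral_mul_const, hπ1, one_mul]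
  exact min_le_left _ _

/-- Geometric convergence of a two-stage chain from drift and minorization. -/
theorem DriftMinorization.abs_sub_le (h : DriftMinorization μ ν S T V ψ lam L d ε)
    (hl0 : 0 ≤ lam) (hl1 : lam < 1) (hL : 1 ≤ L) (hd : 0 < d)
    (hε0 : 0 ≤ ε) (hε : ε < 1) (hs0 : 0 ≤ s) (hs1 : s ≤ 1 / 2) (hκ : 0 < κ)
    (hout : ((1 + 2 * L + lam * d) / (1 + d)) ^ s ≤ κ)
    (hin : (1 - ε) * ((1 + 2 * (lam * d + L)) / (1 - ε)) ^ s ≤ κ)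
    {π : E → ℝ} (hπ0 : ∀ b, 0 ≤ π b) (hπi : Integrable π μ) (hπ1 : ∫ b, π b ∂μ = 1)
    (hstat : ∀ f : E → ℝ, Measurable f → (∃ C, ∀ b, |f b| ≤ C) →
      ∫ b, π b * densOp ν T (densOp μ S f) b ∂μ = ∫ b, π b * f b ∂μ)
    {g : E → ℝ} (hg : Measurable g) (hC : ∀ b, |g b| ≤ 1) (M : ℕ) (b₀ : E) :
    densOp ν T ((pairOp μ ν S T)^[M] (densOp μ S g)) b₀ - ∫ b, π b * g b ∂μ ≤
      κ ^ M * (2 + L / (1 - lam) + densOp ν T V b₀) := by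
  have hSg := h.densS.measurable_densOp hg
  have hSb := h.densS.abs_densOp_le hg hC
  have hreg := fun M => h.iterate_regular hSg hSb M
  have hst : ∀ M : ℕ, ∫ b, π b * densOp ν T ((pairOp μ ν S T)^[M] (densOp μ S g)) b ∂μ =
      ∫ b, π b * g b ∂μ := by
    intro M
    induction M with
    | zero => exact hstat g hg ⟨1, hC⟩
    | succ M ih =>
      rw [Function.iterate_succ_apply', ← ih]
      exact hstat _ (h.densT.measurable_densOp (hreg M).1)
        ⟨1, h.densT.abs_densOp_le (hreg M).1 (hreg M).2⟩
  set q := (pairOp μ ν S T)^[M] (densOp μ S g) with hq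
  set W := densOp ν T V with hW
  have hκM : 0 < κ ^ M := by positivity
  -- The left side never exceeds 2, so W(b) may be cut at 2/κ^M, the level where the bound becomes
  -- trivial. Thus only a truncated stationary moment is needed.
  have hdiff : ∀ b, densOp ν T q b₀ - densOp ν T q b ≤
      κ ^ M * (2 + W b₀ + min (W b) (2 / κ ^ M)) := by
    intro b
    have h1 := h.densOp_sub_le (A := 2 * κ ^ M) (B := κ ^ M) (hreg M).1 (hreg M).2
      (fun z z' => (h.iterate_contraction hl0 hl1 hL hd hε0 hε hs0 hs1 hκ.le hout hin hSg hSb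
        M z z').trans (le_of_eq (by ring))) b₀ b
    have hb := abs_le.1 (h.densT.abs_densOp_le (hreg M).1 (hreg M).2 b)
    have hb0 := abs_le.1 (h.densT.abs_densOp_le (hreg M).1 (hreg M).2 b₀)
    rcases min_cases (W b) (2 / κ ^ M) with ⟨he, _⟩ | ⟨he, _⟩
    · rw [he]; linarith
    · rw [he, mul_add, mul_div_cancel₀ _ hκM.ne']
      have : 0 ≤ κ ^ M * (2 + W b₀) := mul_nonneg hκM.le (by linarith [h.nonneg_densOp b₀])
      linarith
  have hTm := h.densT.measurable_densOp (hreg M).1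
  have hTb := h.densT.abs_densOp_le (hreg M).1 (hreg M).2
  have hWm : Measurable W := h.densT.measurable_densOp h.measV
  have hc : 0 ≤ 2 / κ ^ M := by positivity
  have imin : Integrable (fun b => π b * min (W b) (2 / κ ^ M)) μ :=
    integrable_mul_of_abs_le (C := 2 / κ ^ M) hπi (by fun_prop) fun b => by
      rw [abs_of_nonneg (le_min (h.nonneg_densOp b) hc)]
      exact min_le_right _ _
  have iT : Integrable (fun b => π b * densOp ν T q b) μ := integrable_mul_of_abs_le hπi hTm hTb
  have hfin : densOp ν T q b₀ - ∫ b, π b * densOp ν T q b ∂μ ≤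
      κ ^ M * (2 + W b₀ + ∫ b, π b * min (W b) (2 / κ ^ M) ∂μ) := by
    have e1 : densOp ν T q b₀ - ∫ b, π b * densOp ν T q b ∂μ =
        ∫ b, (π b * densOp ν T q b₀ - π b * densOp ν T q b) ∂μ := by
      rw [integral_sub (hπi.mul_const _) iT, integral_mul_const, hπ1, one_mul]
    have e2 : κ ^ M * (2 + W b₀ + ∫ b, π b * min (W b) (2 / κ ^ M) ∂μ) =
        ∫ b, (π b * (κ ^ M * (2 + W b₀)) + κ ^ M * (π b * min (W b) (2 / κ ^ M))) ∂μ := by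
      rw [integral_add (hπi.mul_const _) (imin.const_mul _), integral_mul_const, hπ1, one_mul,
        integral_const_mul]
      ring
    rw [e1, e2]
    refine integral_mono ((hπi.mul_const _).sub iT)
      ((hπi.mul_const _).add (imin.const_mul _)) fun b => ?_
    have := mul_le_mul_of_nonneg_left (hdiff b) (hπ0 b)
    simp only
    linarith
  rw [hst M] at hfin
  refine hfin.trans ?_
  have := h.integral_min_le hl0 hl1 (by linarith) hπ0 hπi hπ1 hstat hc
  refine mul_le_mul_of_nonneg_left ?_ hκM.le
  linarith

end Convergence

/-! ### What propriety says about directions and tails -/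

variable {n p : ℕ} {X : Matrix (Fin n) (Fin p) ℝ} {Y : Fin n → Bool}
  {Q : Matrix (Fin p) (Fin p) ℝ} {v : Fin p → ℝ}

/-- The linear predictors, with the sign of the corresponding response. -/
def signedPred (X : Matrix (Fin n) (Fin p) ℝ) (Y : Fin n → Bool) (β : Fin p → ℝ) (i : Fin n) : ℝ :=
  sgn (Y i) * (X *ᵥ β) i

theorem signedPred_add_smul (b α : Fin p → ℝ) (t : ℝ) (i : Fin n) :
    signedPred X Y (b + t • α) i = signedPred X Y b i + t * signedPred X Y α i := by
  simp only [signedPred, mulVec_add, mulVec_smul, Pi.add_apply, Pi.smul_apply, smul_eq_mul]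
  ring

theorem continuous_signedPred (i : Fin n) : Continuous fun β => signedPred X Y β i := by
  have : Continuous fun β => X *ᵥ β := by fun_prop
  exact continuous_const.mul ((continuous_apply i).comp this)

theorem likelihood_eq (β : Fin p → ℝ) :
    likelihood X Y β = ∏ i, stdCDF (signedPred X Y β i) := by
  refine Finset.prod_congr rfl fun i _ => ?_
  rcases h : Y i with _ | _ <;> simp [signedPred, sgn, h, one_sub_stdCDF]

theorem unnormPosterior_pos (β : Fin p → ℝ) : 0 < unnormPosterior X Y Q v β := by
  rw [unnormPosterior, likelihood_eq]
  exact mul_pos (Finset.prod_pos fun i _ => stdCDF_pos _) (Real.exp_pos _)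

theorem continuous_unnormPosterior : Continuous (unnormPosterior X Y Q v) := by
  have h1 : Continuous fun β : Fin p → ℝ => ∏ i, stdCDF (signedPred X Y β i) :=
    continuous_finsetProd _ fun i _ => continuous_stdCDF.comp (continuous_signedPred i)
  have h2 : unnormPosterior X Y Q v =
      fun β => (∏ i, stdCDF (signedPred X Y β i)) * prior Q v β := by
    ext β; rw [unnormPosterior, likelihood_eq]
  have h3 : Continuous (prior Q v) := by
    have : Continuous fun β : Fin p → ℝ => Q *ᵥ (β - v) := by fun_prop
    unfold prior
    fun_prop
  rw [h2]
  exact h1.mul h3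

theorem integral_unnormPosterior_pos (hproper : ProperPosterior X Y Q v) :
    0 < ∫ b, unnormPosterior X Y Q v b := by
  rw [integral_pos_iff_support_of_nonneg (fun b => (unnormPosterior_pos b).le) hproper]
  have : Function.support (unnormPosterior X Y Q v) = Set.univ :=
    Set.eq_univ_of_forall fun b => (unnormPosterior_pos b).ne'
  rw [this]
  exact isOpen_univ.measure_pos _ Set.univ_nonempty

/-- With a flat prior, propriety excludes directions along which no success probability drops. -/
theorem exists_signedPred_neg (hproper : ProperPosterior X Y 0 v) {α : Fin p → ℝ} (hα : α ≠ 0) :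
    ∃ i, signedPred X Y α i < 0 := by
  by_contra! hcon
  set f := unnormPosterior X Y 0 v with hf
  have hmono : ∀ (k : ℕ) (x : Fin p → ℝ), f x ≤ f (x + (k : ℝ) • α) := by
    intro k x
    have hp : ∀ y : Fin p → ℝ, prior 0 v y = 1 := fun y => by simp [prior]
    simp only [hf, unnormPosterior, hp, mul_one, likelihood_eq]
    refine Finset.prod_le_prod (fun i _ => (stdCDF_pos _).le) fun i _ => stdCDF_mono ?_
    rw [signedPred_add_smul]
    exact le_add_of_nonneg_right (mul_nonneg k.cast_nonneg (hcon i))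
  have hpos : 0 < ∫ x in Metric.ball (0 : Fin p → ℝ) 1, f x := by
    rw [setIntegral_pos_iff_support_of_nonneg_ae (.of_forall fun b => (unnormPosterior_pos b).le)
      hproper.integrableOn]
    have : Function.support f = Set.univ :=
      Set.eq_univ_of_forall fun b => (unnormPosterior_pos b).ne'
    rw [this, Set.univ_inter]
    exact Metric.measure_ball_pos _ _ one_pos
  -- If no signed predictor decreases along α, translating the unit ball by kα cannot lose mass.
  -- Integrability forces the mass of the escaping balls to 0, a contradiction.
  have hle : ∀ k : ℕ, ∫ x in Metric.ball (0 : Fin p → ℝ) 1, f x ≤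
      ∫ x, (Metric.ball ((k : ℝ) • α) 1).indicator f x := by
    intro k
    rw [← integral_indicator measurableSet_ball,
      ← integral_add_right_eq_self (μ := volume)
        ((Metric.ball ((k : ℝ) • α) 1).indicator f) ((k : ℝ) • α)]
    refine integral_mono (hproper.indicator measurableSet_ball)
      ((hproper.indicator measurableSet_ball).comp_add_right _) fun x => ?_
    by_cases hx : x ∈ Metric.ball (0 : Fin p → ℝ) 1
    · have hx' : x + (k : ℝ) • α ∈ Metric.ball ((k : ℝ) • α) 1 := by
        simpa [Metric.mem_ball, dist_eq_norm] using hx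
      simp only [Set.indicator_of_mem hx, Set.indicator_of_mem hx']
      exact hmono k x
    · simp only [Set.indicator_of_notMem hx]
      exact Set.indicator_nonneg (fun y _ => (unnormPosterior_pos y).le) _
  have hlim : Filter.Tendsto (fun k : ℕ => ∫ x, (Metric.ball ((k : ℝ) • α) 1).indicator f x)
      Filter.atTop (nhds (∫ _ : Fin p → ℝ, (0 : ℝ))) := by
    refine tendsto_integral_of_dominated_convergence f
      (fun k => (hproper.indicator measurableSet_ball).aestronglyMeasurable) hproper
      (fun k => .of_forall fun x => ?_) (.of_forall fun x => ?_)
    · refine (norm_indicator_le_norm_self _ _).trans ?_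
      rw [Real.norm_of_nonneg (unnormPosterior_pos x).le]
    · have hnorm : 0 < ‖α‖ := norm_pos_iff.2 hα
      obtain ⟨N, hN⟩ := exists_nat_gt ((1 + ‖x‖) / ‖α‖)
      refine tendsto_const_nhds.congr' ?_
      filter_upwards [Filter.eventually_ge_atTop N] with k hk
      rw [Set.indicator_of_notMem]
      rw [Metric.mem_ball, dist_eq_norm, not_lt]
      have h1 : (1 + ‖x‖) < k * ‖α‖ := by
        rw [div_lt_iff₀ hnorm] at hN
        refine hN.trans_le ?_
        gcongr
      have h2 : ‖(k : ℝ) • α‖ = k * ‖α‖ := by rw [norm_smul]; simp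
      have h3 := norm_sub_norm_le ((k : ℝ) • α) x
      rw [norm_sub_rev, h2] at h3
      linarith
  have := ge_of_tendsto' hlim hle
  simp only [integral_zero] at this
  linarith

/-- The directional information: prior precision plus squares of decreasing predictors. -/
def descent (X : Matrix (Fin n) (Fin p) ℝ) (Y : Fin n → Bool) (Q : Matrix (Fin p) (Fin p) ℝ)
    (α : Fin p → ℝ) : ℝ :=
  α ⬝ᵥ (Q *ᵥ α) + ∑ i, min (signedPred X Y α i) 0 ^ 2

theorem posSemidef_of_posDef_or_zero (hQ : Q.PosDef ∨ Q = 0) : Q.PosSemidef := by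
  rcases hQ with h | rfl
  · exact h.posSemidef
  · exact PosSemidef.zero

theorem quad_nonneg {k : ℕ} {A : Matrix (Fin k) (Fin k) ℝ} (hA : A.PosSemidef)
    (x : Fin k → ℝ) : 0 ≤ x ⬝ᵥ (A *ᵥ x) := by
  simpa using hA.dotProduct_mulVec_nonneg x

theorem quad_pos {k : ℕ} {A : Matrix (Fin k) (Fin k) ℝ} (hA : A.PosDef)
    {x : Fin k → ℝ} (hx : x ≠ 0) : 0 < x ⬝ᵥ (A *ᵥ x) := by
  simpa using hA.dotProduct_mulVec_pos hx

theorem quad_comm {k : ℕ} {A : Matrix (Fin k) (Fin k) ℝ} (hA : A.PosSemidef)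
    (x y : Fin k → ℝ) : x ⬝ᵥ (A *ᵥ y) = y ⬝ᵥ (A *ᵥ x) := by
  have h : Aᵀ = A := by
    have := hA.isHermitian
    rwa [IsHermitian, conjTranspose_eq_transpose_of_trivial] at this
  rw [dotProduct_mulVec, ← mulVec_transpose, h, dotProduct_comm]

/-- A positive definite Q suffices by itself; for Q = 0 a strictly decreasing signed predictor
supplies the positive square. -/
theorem descent_pos (hQ : Q.PosDef ∨ Q = 0) (hproper : ProperPosterior X Y Q v)
    {α : Fin p → ℝ} (hα : α ≠ 0) : 0 < descent X Y Q α := by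
  rcases hQ with h | rfl
  · exact add_pos_of_pos_of_nonneg (quad_pos h hα)
      (Finset.sum_nonneg fun i _ => sq_nonneg _)
  · obtain ⟨i, hi⟩ := exists_signedPred_neg hproper hα
    refine add_pos_of_nonneg_of_pos (by simp) ?_
    refine Finset.sum_pos' (fun i _ => sq_nonneg _) ⟨i, Finset.mem_univ _, ?_⟩
    rw [min_eq_left hi.le]
    exact sq_pos_of_neg hi

theorem continuous_quad {k : ℕ} (A : Matrix (Fin k) (Fin k) ℝ) :
    Continuous fun x : Fin k → ℝ => x ⬝ᵥ (A *ᵥ x) := by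
  have : Continuous fun x : Fin k → ℝ => A *ᵥ x := by fun_prop
  fun_prop

theorem continuous_descent : Continuous (descent X Y Q) := by
  refine (continuous_quad Q).add (continuous_finsetSum _ fun i _ => ?_)
  exact ((continuous_signedPred i).min continuous_const).pow 2

theorem quad_smul {k : ℕ} (A : Matrix (Fin k) (Fin k) ℝ) (t : ℝ) (x : Fin k → ℝ) :
    (t • x) ⬝ᵥ (A *ᵥ (t • x)) = t ^ 2 * (x ⬝ᵥ (A *ᵥ x)) := by
  rw [mulVec_smul, smul_dotProduct, dotProduct_smul, smul_eq_mul, smul_eq_mul]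
  ring

theorem descent_smul {t : ℝ} (ht : 0 ≤ t) (α : Fin p → ℝ) :
    descent X Y Q (t • α) = t ^ 2 * descent X Y Q α := by
  rw [descent, quad_smul, descent, mul_add, Finset.mul_sum]
  congr 1
  refine Finset.sum_congr rfl fun i _ => ?_
  have h : signedPred X Y (t • α) i = t * signedPred X Y α i := by
    have := signedPred_add_smul (X := X) (Y := Y) 0 α t i
    simpa [signedPred] using this
  rw [h, ← mul_pow, mul_min_of_nonneg _ _ ht, mul_zero]

/-- A continuous function, homogeneous of degree two and positive away from the origin, dominates
a multiple of the squared norm. -/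
theorem exists_mul_sq_norm_le {k : ℕ} {F : (Fin k → ℝ) → ℝ} (hF : Continuous F)
    (hpos : ∀ x, x ≠ 0 → 0 < F x) (hhom : ∀ t : ℝ, 0 ≤ t → ∀ x, F (t • x) = t ^ 2 * F x) :
    ∃ c > 0, ∀ x, c * ‖x‖ ^ 2 ≤ F x := by
  have h0 : F 0 = 0 := by simpa using hhom 0 le_rfl 0
  rcases (Metric.sphere (0 : Fin k → ℝ) 1).eq_empty_or_nonempty with he | hne
  · refine ⟨1, one_pos, fun x => ?_⟩
    by_cases hx : x = 0
    · simp [hx, h0]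
    · exfalso
      have : ‖x‖⁻¹ • x ∈ Metric.sphere (0 : Fin k → ℝ) 1 := by
        simp [norm_smul, hx]
      rw [he] at this
      exact this
  · obtain ⟨y, hy, hmin⟩ := (isCompact_sphere (0 : Fin k → ℝ) 1).exists_isMinOn hne
      hF.continuousOn
    have hy0 : y ≠ 0 := by
      rintro rfl
      simp at hy
    refine ⟨F y, hpos y hy0, fun x => ?_⟩
    by_cases hx : x = 0
    · simp [hx, h0]
    · have hxs : ‖x‖⁻¹ • x ∈ Metric.sphere (0 : Fin k → ℝ) 1 := by
        simp [norm_smul, hx]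
      have h1 : F y ≤ F (‖x‖⁻¹ • x) := hmin hxs
      have h2 : F x = ‖x‖ ^ 2 * F (‖x‖⁻¹ • x) := by
        rw [← hhom _ (norm_nonneg x), smul_smul, mul_inv_cancel₀ (norm_ne_zero_iff.2 hx), one_smul]
      rw [h2, mul_comm]
      gcongr

theorem exists_descent_bound (hQ : Q.PosDef ∨ Q = 0) (hproper : ProperPosterior X Y Q v) :
    ∃ c > 0, ∀ α, c * ‖α‖ ^ 2 ≤ descent X Y Q α :=
  exists_mul_sq_norm_le continuous_descent (fun _ h => descent_pos hQ hproper h)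
    fun _ ht α => descent_smul ht α

theorem quad_sigmaMat (α : Fin p → ℝ) :
    α ⬝ᵥ (sigmaMat X Q *ᵥ α) = (X *ᵥ α) ⬝ᵥ (X *ᵥ α) + α ⬝ᵥ (Q *ᵥ α) := by
  rw [sigmaMat, add_mulVec, dotProduct_add, ← mulVec_mulVec, dotProduct_mulVec, vecMul_transpose]

theorem sq_signedPred (α : Fin p → ℝ) (i : Fin n) :
    signedPred X Y α i ^ 2 = (X *ᵥ α) i ^ 2 := by
  rw [signedPred, mul_pow, sq (sgn _), sgn_mul_self, one_mul]

theorem sum_sq_signedPred (α : Fin p → ℝ) :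
    (X *ᵥ α) ⬝ᵥ (X *ᵥ α) = ∑ i, signedPred X Y α i ^ 2 := by
  simp only [dotProduct, sq_signedPred]
  exact Finset.sum_congr rfl fun i _ => (sq _).symm

theorem sq_min_le (x : ℝ) : min x 0 ^ 2 ≤ x ^ 2 := by
  rcases min_cases x 0 with ⟨h, _⟩ | ⟨h, _⟩ <;> rw [h]
  simpa using sq_nonneg x

theorem sigmaMat_posDef (hQ : Q.PosDef ∨ Q = 0) (hproper : ProperPosterior X Y Q v) :
    (sigmaMat X Q).PosDef := by
  have hpsd : (sigmaMat X Q).PosSemidef := by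
    have := (posSemidef_conjTranspose_mul_self X).add (posSemidef_of_posDef_or_zero hQ)
    rwa [conjTranspose_eq_transpose_of_trivial] at this
  refine PosDef.of_dotProduct_mulVec_pos hpsd.isHermitian fun {x} hx => ?_
  have h1 := descent_pos hQ hproper hx
  rw [star_trivial, quad_sigmaMat, sum_sq_signedPred (Y := Y)]
  rw [descent] at h1
  have h2 : ∑ i, min (signedPred X Y x i) 0 ^ 2 ≤ ∑ i, signedPred X Y x i ^ 2 :=
    Finset.sum_le_sum fun i _ => sq_min_le _
  linarith

/-- For θ ≤ 0 the tilted mass is at most its value at 0, so Φ(θ) ≤ exp(-θ²/2) Φ(0). -/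
theorem stdCDF_le_exp (θ : ℝ) : stdCDF θ ≤ Real.exp (-(1 / 2) * min θ 0 ^ 2) := by
  rcases le_total 0 θ with h | h
  · rw [min_eq_right h]
    have h1 : stdCDF θ ≤ 1 := measureReal_le_one
    simpa using h1
  · rw [min_eq_left h]
    have h1 : tiltMoment 0 θ ≤ tiltMoment 0 0 := by
      refine setIntegral_mono_on (integrableOn_tilt 0 θ) (integrableOn_tilt 0 0)
        measurableSet_Ioi fun u hu => ?_
      have hu' : (0 : ℝ) < u := hu
      have : θ * u ≤ 0 := mul_nonpos_of_nonpos_of_nonneg h hu'.le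
      gcongr
    have h2 : stdCDF 0 ≤ 1 := measureReal_le_one
    rw [stdCDF_eq] at h2 ⊢
    have h3 : stdPDF θ = Real.exp (-(1 / 2) * θ ^ 2) * stdPDF 0 := by
      rw [stdPDF_eq, stdPDF_eq]
      simp only [ne_eq, OfNat.ofNat_ne_zero, not_false_eq_true, zero_pow, zero_div, neg_zero,
        Real.exp_zero, mul_one]
      rw [mul_comm]
      congr 2
      ring
    calc stdPDF θ * tiltMoment 0 θ ≤ stdPDF θ * tiltMoment 0 0 :=
          mul_le_mul_of_nonneg_left h1 (stdPDF_pos θ).le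
      _ = Real.exp (-(1 / 2) * θ ^ 2) * (stdPDF 0 * tiltMoment 0 0) := by rw [h3]; ring
      _ ≤ _ := mul_le_of_le_one_right (Real.exp_pos _).le h2

theorem unnormPosterior_le (hQ : Q.PosSemidef) (β : Fin p → ℝ) :
    unnormPosterior X Y Q v β ≤
      Real.exp (1 / 2 * (v ⬝ᵥ (Q *ᵥ v)) - 1 / 4 * descent X Y Q β) := by
  have h1 : likelihood X Y β ≤
      Real.exp (-(1 / 2) * ∑ i, min (signedPred X Y β i) 0 ^ 2) := by
    rw [likelihood_eq, Finset.mul_sum, Real.exp_sum]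
    exact Finset.prod_le_prod (fun i _ => (stdCDF_pos _).le) fun i _ => stdCDF_le_exp _
  have h2 : -(1 / 2) * ((β - v) ⬝ᵥ (Q *ᵥ (β - v))) ≤
      1 / 2 * (v ⬝ᵥ (Q *ᵥ v)) - 1 / 4 * (β ⬝ᵥ (Q *ᵥ β)) := by
    -- Centring at 2v is the choice that yields (β - v)ᵀQ(β - v) ≥ ½βᵀQβ - vᵀQv.
    have h3 := quad_nonneg hQ (β - (2 : ℝ) • v)
    have h4 := quad_comm hQ v β
    simp only [mulVec_sub, mulVec_smul, sub_dotProduct, dotProduct_sub, smul_dotProduct,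
      dotProduct_smul, smul_eq_mul] at h3 ⊢
    linarith
  have h5 : 0 ≤ ∑ i, min (signedPred X Y β i) 0 ^ 2 := Finset.sum_nonneg fun i _ => sq_nonneg _
  rw [unnormPosterior, prior]
  calc _ ≤ Real.exp (-(1 / 2) * ∑ i, min (signedPred X Y β i) 0 ^ 2) *
      Real.exp (-(1 / 2) * ((β - v) ⬝ᵥ (Q *ᵥ (β - v)))) := by gcongr
    _ ≤ _ := by
      rw [← Real.exp_add]
      refine Real.exp_le_exp.2 ?_
      rw [descent]
      linarith

/-! ### The posterior mode: existence and the fixed-point equation -/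

theorem posterior_le_iff (hproper : ProperPosterior X Y Q v) (β b : Fin p → ℝ) :
    posterior X Y Q v β ≤ posterior X Y Q v b ↔
      unnormPosterior X Y Q v β ≤ unnormPosterior X Y Q v b :=
  div_le_div_iff_of_pos_right (integral_unnormPosterior_pos hproper)

theorem exists_posteriorMode (hQ : Q.PosDef ∨ Q = 0) (hproper : ProperPosterior X Y Q v) :
    ∃ b, IsPosteriorMode X Y Q v b := by
  obtain ⟨c, hc, hcb⟩ := exists_descent_bound hQ hproper
  have hQs := posSemidef_of_posDef_or_zero hQ
  have hlim : Filter.Tendsto (unnormPosterior X Y Q v) (Filter.cocompact _) (nhds 0) := by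
    have h1 : Filter.Tendsto (fun β : Fin p → ℝ => 1 / 2 * (v ⬝ᵥ (Q *ᵥ v)) - c / 4 * ‖β‖ ^ 2)
        (Filter.cocompact _) Filter.atBot := by
      have h2 : Filter.Tendsto (fun β : Fin p → ℝ => c / 4 * ‖β‖ ^ 2) (Filter.cocompact _)
          Filter.atTop :=
        ((Filter.tendsto_pow_atTop two_ne_zero).comp
          (tendsto_norm_cocompact_atTop (E := Fin p → ℝ))).const_mul_atTop (by positivity)
      simp_rw [sub_eq_add_neg]
      exact Filter.tendsto_atBot_add_const_left _ _ (Filter.tendsto_neg_atTop_atBot.comp h2)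
    refine squeeze_zero (fun β => (unnormPosterior_pos β).le) (fun β => ?_)
      (Real.tendsto_exp_atBot.comp h1)
    refine (unnormPosterior_le hQs β).trans (Real.exp_le_exp.2 ?_)
    have := hcb β
    linarith
  obtain ⟨b, hb⟩ := (continuous_unnormPosterior (X := X) (Y := Y) (Q := Q) (v := v)).exists_forall_ge'
    0 ((hlim.eventually_lt_const (unnormPosterior_pos 0)).mono fun _ h => h.le)
  exact ⟨b, fun β => (posterior_le_iff hproper β b).2 (hb β)⟩

/-- The vector of truncated normal means. -/
def meanVec (X : Matrix (Fin n) (Fin p) ℝ) (Y : Fin n → Bool) (β : Fin p → ℝ) : Fin n → ℝ :=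
  fun i => truncMean ((X *ᵥ β) i) (Y i)

theorem meanVec_eq (β : Fin p → ℝ) (i : Fin n) :
    meanVec X Y β i = (X *ᵥ β) i + sgn (Y i) * mills (signedPred X Y β i) := rfl

theorem log_unnormPosterior (β : Fin p → ℝ) :
    Real.log (unnormPosterior X Y Q v β) =
      ∑ i, Real.log (stdCDF (signedPred X Y β i)) - 1 / 2 * ((β - v) ⬝ᵥ (Q *ᵥ (β - v))) := by
  rw [unnormPosterior, likelihood_eq, prior, Real.log_mul
    (Finset.prod_pos fun i _ => stdCDF_pos _).ne' (Real.exp_pos _).ne', Real.log_exp,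
    Real.log_prod fun i _ => (stdCDF_pos _).ne']
  ring

theorem hasDerivAt_log_unnormPosterior (hQ : Q.PosSemidef) (b α : Fin p → ℝ) :
    HasDerivAt (fun t : ℝ => Real.log (unnormPosterior X Y Q v (b + t • α)))
      (α ⬝ᵥ (Xᵀ *ᵥ (meanVec X Y b - X *ᵥ b) - Q *ᵥ (b - v))) 0 := by
  simp_rw [log_unnormPosterior, signedPred_add_smul]
  have h1 : ∀ i, HasDerivAt
      (fun t : ℝ => Real.log (stdCDF (signedPred X Y b i + t * signedPred X Y α i)))
      (mills (signedPred X Y b i) * signedPred X Y α i) 0 := by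
    intro i
    have e1 : HasDerivAt (fun t : ℝ => signedPred X Y b i + t * signedPred X Y α i)
        (signedPred X Y α i) 0 := by
      simpa using ((hasDerivAt_id (0 : ℝ)).mul_const (signedPred X Y α i)).const_add
        (signedPred X Y b i)
    have e2 := (hasDerivAt_stdCDF (signedPred X Y b i + 0 * signedPred X Y α i)).comp 0 e1
    have e3 := e2.log (stdCDF_pos _).ne'
    refine e3.congr_deriv ?_
    simp only [Function.comp_apply, zero_mul, add_zero, mills]
    ring
  have h2 : HasDerivAt (fun t : ℝ => 1 / 2 * ((b + t • α - v) ⬝ᵥ (Q *ᵥ (b + t • α - v))))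
      (α ⬝ᵥ (Q *ᵥ (b - v))) 0 := by
    have e : (fun t : ℝ => 1 / 2 * ((b + t • α - v) ⬝ᵥ (Q *ᵥ (b + t • α - v)))) =
        fun t : ℝ => 1 / 2 * ((b - v) ⬝ᵥ (Q *ᵥ (b - v))) + t * (α ⬝ᵥ (Q *ᵥ (b - v))) +
          t ^ 2 * (1 / 2 * (α ⬝ᵥ (Q *ᵥ α))) := by
      ext t
      have e0 : b + t • α - v = (b - v) + t • α := by abel
      have e1 := quad_comm hQ (b - v) α
      rw [e0]
      simp only [mulVec_add, mulVec_smul, add_dotProduct, dotProduct_add, smul_dotProduct,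
        dotProduct_smul, smul_eq_mul, e1]
      ring
    rw [e]
    have := ((((hasDerivAt_id (0 : ℝ)).mul_const (α ⬝ᵥ (Q *ᵥ (b - v)))).const_add
      (1 / 2 * ((b - v) ⬝ᵥ (Q *ᵥ (b - v))))).add
      (((hasDerivAt_id (0 : ℝ)).pow 2).mul_const (1 / 2 * (α ⬝ᵥ (Q *ᵥ α)))))
    refine this.congr_deriv ?_
    simp
  refine ((HasDerivAt.fun_sum fun i _ => h1 i).sub h2).congr_deriv ?_
  rw [dotProduct_sub]
  congr 1
  rw [dotProduct_mulVec, vecMul_transpose, dotProduct]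
  refine Finset.sum_congr rfl fun i _ => ?_
  rw [Pi.sub_apply, meanVec_eq, signedPred, signedPred]
  ring

/-- A posterior mode is a fixed point of the expected update. -/
theorem IsPosteriorMode.sigmaMat_mulVec (hQ : Q.PosDef ∨ Q = 0)
    (hproper : ProperPosterior X Y Q v) {b : Fin p → ℝ} (hb : IsPosteriorMode X Y Q v b) :
    sigmaMat X Q *ᵥ b = Xᵀ *ᵥ meanVec X Y b + Q *ᵥ v := by
  have hQs := posSemidef_of_posDef_or_zero hQ
  -- The test direction is the gradient itself, so the vanishing derivative reads α ⬝ᵥ α = 0.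
  set α := Xᵀ *ᵥ (meanVec X Y b - X *ᵥ b) - Q *ᵥ (b - v) with hα
  have hd := hasDerivAt_log_unnormPosterior (X := X) (Y := Y) (v := v) hQs b α
  have hmax : IsLocalMax (fun t : ℝ => Real.log (unnormPosterior X Y Q v (b + t • α))) 0 := by
    refine .of_forall fun t => ?_
    simp only [zero_smul, add_zero]
    exact Real.log_le_log (unnormPosterior_pos _)
      ((posterior_le_iff hproper _ _).1 (hb (b + t • α)))
  have h0 := hmax.hasDerivAt_eq_zero hd
  have h1 : α = 0 := dotProduct_self_eq_zero.1 h0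
  rw [hα, mulVec_sub, mulVec_sub, mulVec_mulVec] at h1
  rw [sigmaMat, add_mulVec]
  have : Xᵀ *ᵥ meanVec X Y b + Q *ᵥ v - ((Xᵀ * X) *ᵥ b + Q *ᵥ b) = 0 := by
    rw [← h1]; abel
  exact (sub_eq_zero.1 this).symm

/-! ### Contraction of the expected update and uniqueness of the mode -/

theorem mulVec_dotProduct_eq (α : Fin p → ℝ) (u : Fin n → ℝ) :
    (X *ᵥ α) ⬝ᵥ u = α ⬝ᵥ (Xᵀ *ᵥ u) := by
  rw [dotProduct_mulVec, vecMul_transpose]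

theorem mulVec_inv_mulVec {A : Matrix (Fin p) (Fin p) ℝ} (hA : A.PosDef) (y : Fin p → ℝ) :
    A *ᵥ (A⁻¹ *ᵥ y) = y := by
  rw [mulVec_mulVec, mul_nonsing_inv _ (isUnit_iff_ne_zero.2 hA.det_pos.ne'), one_mulVec]

theorem inv_mulVec_mulVec {A : Matrix (Fin p) (Fin p) ℝ} (hA : A.PosDef) (y : Fin p → ℝ) :
    A⁻¹ *ᵥ (A *ᵥ y) = y := by
  rw [mulVec_mulVec, nonsing_inv_mul _ (isUnit_iff_ne_zero.2 hA.det_pos.ne'), one_mulVec]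

/-- `X Σ⁻¹ Xᵀ` is dominated by the identity. -/
theorem quad_inv_transpose_le (hQ : Q.PosSemidef) (hS : (sigmaMat X Q).PosDef)
    (u : Fin n → ℝ) :
    (Xᵀ *ᵥ u) ⬝ᵥ ((sigmaMat X Q)⁻¹ *ᵥ (Xᵀ *ᵥ u)) ≤ u ⬝ᵥ u := by
  set w := (sigmaMat X Q)⁻¹ *ᵥ (Xᵀ *ᵥ u) with hw
  have h1 : w ⬝ᵥ (sigmaMat X Q *ᵥ w) = (X *ᵥ w) ⬝ᵥ u := by
    rw [hw, mulVec_inv_mulVec hS, ← hw, mulVec_dotProduct_eq (X := X)]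
  have h2 := quad_sigmaMat (X := X) (Q := Q) w
  have h3 := quad_nonneg hQ w
  have h4 : 0 ≤ (u - X *ᵥ w) ⬝ᵥ (u - X *ᵥ w) := by
    rw [← sqNorm_eq]; exact sqNorm_nonneg _
  rw [sub_dotProduct, dotProduct_sub, dotProduct_sub, dotProduct_comm u (X *ᵥ w)] at h4
  rw [dotProduct_comm, ← mulVec_dotProduct_eq]
  linarith

/-- By cyclicity the trace is tr(Σ⁻¹(Σ - Q)) = p - tr(Σ⁻¹Q), and the subtracted trace is that of
Σ^{-1/2} Q Σ^{-1/2}, hence nonnegative. -/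
theorem trace_hat_le (hQ : Q.PosSemidef) (hS : (sigmaMat X Q).PosDef) :
    (X * (sigmaMat X Q)⁻¹ * Xᵀ).trace ≤ p := by
  set A := sigmaMat X Q with hA
  have hdet : IsUnit A.det := isUnit_iff_ne_zero.2 hS.det_pos.ne'
  set R := (matSqrt A)⁻¹ with hR
  have hRR : A⁻¹ = R * R := by rw [hR, ← Matrix.mul_inv_rev, matSqrt_mul_self hS.posSemidef]
  have hRt : Rᵀ = R := by rw [hR, transpose_nonsing_inv, transpose_matSqrt]
  have h1 : (X * A⁻¹ * Xᵀ).trace = (A⁻¹ * (A - Q)).trace := by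
    rw [trace_mul_comm, ← Matrix.mul_assoc, trace_mul_comm]
    congr 2
    rw [hA, sigmaMat, add_sub_cancel_right]
  have h2 : 0 ≤ (A⁻¹ * Q).trace := by
    have h3 := (hQ.conjTranspose_mul_mul_same R).trace_nonneg
    rw [conjTranspose_eq_transpose_of_trivial, hRt] at h3
    rwa [hRR, Matrix.mul_assoc, trace_mul_comm]
  rw [h1, Matrix.mul_sub, trace_sub, nonsing_inv_mul _ hdet, trace_one, Fintype.card_fin]
  linarith

/-- The diagonal entries of `D(β)`. -/
theorem dMat_eq (β : Fin p → ℝ) :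
    dMat X Y β = Matrix.diagonal fun i => 1 - gFun (signedPred X Y β i) := by
  unfold dMat
  congr 1
  ext i
  rcases h : Y i with _ | _ <;> simp [signedPred, sgn, h]

theorem dMat_mulVec_apply (β : Fin p → ℝ) (u : Fin n → ℝ) (i : Fin n) :
    (dMat X Y β *ᵥ u) i = (1 - gFun (signedPred X Y β i)) * u i := by
  rw [dMat_eq, mulVec_diagonal]

/-- The derivative of the expected update numerator along a ray. -/
def driftVec (X : Matrix (Fin n) (Fin p) ℝ) (Y : Fin n → Bool) (b α : Fin p → ℝ) (t : ℝ) :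
    Fin p → ℝ :=
  Xᵀ *ᵥ (dMat X Y (b + t • α) *ᵥ (X *ᵥ α))

/-- After bounding XΣ⁻¹Xᵀ by the identity, each decreasing coordinate loses a fixed fraction δ of
its square, and discarding αᵀQα from αᵀΣα is a further loss. The total loss is at least δ times
`descent`, which is comparable to the Σ-norm. The factor is uniform in α, so the supremum stays
strictly below 1. -/
theorem exists_contraction_factor (hQ : Q.PosDef ∨ Q = 0) (hproper : ProperPosterior X Y Q v)
    (b : Fin p → ℝ) : ∃ η > 0, ∀ t : ℝ, 0 < t → ∀ α : Fin p → ℝ,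
      driftVec X Y b α t ⬝ᵥ ((sigmaMat X Q)⁻¹ *ᵥ driftVec X Y b α t) ≤
        (1 - η) * (α ⬝ᵥ (sigmaMat X Q *ᵥ α)) := by
  have hQs := posSemidef_of_posDef_or_zero hQ
  have hS := sigmaMat_posDef hQ hproper
  obtain ⟨c, hc, hcb⟩ := exists_descent_bound hQ hproper
  obtain ⟨δ₀, hδ₀, hδb⟩ := exists_gFun_lower_bound (∑ i, |signedPred X Y b i|)
  set δ := min δ₀ 1 with hδ
  have hδ0 : 0 < δ := lt_min hδ₀ one_pos
  have hδ1 : δ ≤ 1 := min_le_right _ _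
  obtain ⟨C, hC, hCb⟩ : ∃ C > 0, ∀ α : Fin p → ℝ, α ⬝ᵥ (sigmaMat X Q *ᵥ α) ≤ C * ‖α‖ ^ 2 := by
    obtain ⟨M, hM⟩ := (isCompact_closedBall (0 : Fin p → ℝ) 1).exists_bound_of_continuousOn
      (continuous_quad (sigmaMat X Q)).continuousOn
    refine ⟨max M 1, by positivity, fun α => ?_⟩
    by_cases hα : α = 0
    · simp [hα]
    have hαn := norm_ne_zero_iff.2 hα
    have h1 := hM (‖α‖⁻¹ • α) (by simp [norm_smul, hαn])
    have h2 : α ⬝ᵥ (sigmaMat X Q *ᵥ α) =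
        ‖α‖ ^ 2 * ((‖α‖⁻¹ • α) ⬝ᵥ (sigmaMat X Q *ᵥ (‖α‖⁻¹ • α))) := by
      rw [← quad_smul, smul_smul, mul_inv_cancel₀ hαn, one_smul]
    rw [h2, mul_comm]
    gcongr
    exact (le_abs_self _).trans (h1.trans (le_max_left _ _))
  refine ⟨δ * c / C, by positivity, fun t ht α => ?_⟩
  have h1 := quad_inv_transpose_le hQs hS (dMat X Y (b + t • α) *ᵥ (X *ᵥ α))
  have h2 : (dMat X Y (b + t • α) *ᵥ (X *ᵥ α)) ⬝ᵥ (dMat X Y (b + t • α) *ᵥ (X *ᵥ α)) ≤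
      ∑ i, (signedPred X Y α i ^ 2 - δ * min (signedPred X Y α i) 0 ^ 2) := by
    rw [dotProduct]
    refine Finset.sum_le_sum fun i _ => ?_
    rw [dMat_mulVec_apply, ← sq, mul_pow, ← sq_signedPred (Y := Y)]
    set g := gFun (signedPred X Y (b + t • α) i) with hg
    have hg0 : 0 < g := gFun_pos _
    have hg1 : g ≤ 1 := gFun_le_one _
    have hsq : (1 - g) ^ 2 ≤ 1 - g := by nlinarith
    rcases lt_or_ge (signedPred X Y α i) 0 with hneg | hpos
    · rw [min_eq_left hneg.le]
      -- For t > 0 a decreasing predictor stays below its value at b, where g has a uniform lower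
      -- bound. Along increasing coordinates g has no such bound and only 1 - g ≤ 1 is used.
      have hle : signedPred X Y (b + t • α) i ≤ ∑ i, |signedPred X Y b i| := by
        rw [signedPred_add_smul]
        have e1 : t * signedPred X Y α i ≤ 0 := mul_nonpos_of_nonneg_of_nonpos ht.le hneg.le
        have e2 := Finset.single_le_sum (f := fun i => |signedPred X Y b i|)
          (fun i _ => abs_nonneg _) (Finset.mem_univ i)
        have e3 := le_abs_self (signedPred X Y b i)
        linarith
      have hgδ : δ ≤ g := (min_le_left _ _).trans (hδb _ hle)
      have := mul_le_mul_of_nonneg_right (hsq.trans (sub_le_sub_left hgδ 1))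
        (sq_nonneg (signedPred X Y α i))
      linarith
    · rw [min_eq_right hpos]
      have := mul_le_mul_of_nonneg_right (hsq.trans (sub_le_self 1 hg0.le))
        (sq_nonneg (signedPred X Y α i))
      linarith
  have h3 := quad_sigmaMat (X := X) (Q := Q) α
  rw [sum_sq_signedPred (Y := Y)] at h3
  rw [Finset.sum_sub_distrib, ← Finset.mul_sum] at h2
  have h4 := hcb α
  have h5 : δ * descent X Y Q α ≤
      α ⬝ᵥ (Q *ᵥ α) + δ * ∑ i, min (signedPred X Y α i) 0 ^ 2 := by
    rw [descent, mul_add]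
    have := mul_le_mul_of_nonneg_right hδ1 (quad_nonneg hQs α)
    linarith
  have h6 : δ * c / C * (α ⬝ᵥ (sigmaMat X Q *ᵥ α)) ≤ δ * descent X Y Q α := by
    calc _ ≤ δ * c / C * (C * ‖α‖ ^ 2) := by
          have := hCb α
          gcongr
      _ = δ * (c * ‖α‖ ^ 2) := by field_simp
      _ ≤ _ := by gcongr
  rw [driftVec]
  linarith

theorem driftRatios_eq (hS : (sigmaMat X Q).PosDef) (b : Fin p → ℝ) :
    driftRatios X Y Q b = {x | ∃ t ∈ Set.Ioo (0 : ℝ) 1, ∃ α : Fin p → ℝ, α ≠ 0 ∧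
      x = driftVec X Y b α t ⬝ᵥ ((sigmaMat X Q)⁻¹ *ᵥ driftVec X Y b α t) /
        (α ⬝ᵥ (sigmaMat X Q *ᵥ α))} := by
  simp_rw [driftRatios, sqNorm_inv_matSqrt_mulVec hS.posSemidef,
    sqNorm_matSqrt_mulVec hS.posSemidef, driftVec]

theorem exists_driftRatios_bound (hQ : Q.PosDef ∨ Q = 0) (hproper : ProperPosterior X Y Q v)
    (b : Fin p → ℝ) : ∃ η > 0, ∀ x ∈ driftRatios X Y Q b, x ≤ 1 - η := by
  have hS := sigmaMat_posDef hQ hproper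
  obtain ⟨η, hη, h⟩ := exists_contraction_factor hQ hproper b
  refine ⟨η, hη, ?_⟩
  rw [driftRatios_eq hS]
  rintro x ⟨t, ht, α, hα, rfl⟩
  rw [div_le_iff₀ (quad_pos hS hα)]
  exact h t ht.1 α

theorem bddAbove_driftRatios (hQ : Q.PosDef ∨ Q = 0) (hproper : ProperPosterior X Y Q v)
    (b : Fin p → ℝ) : BddAbove (driftRatios X Y Q b) := by
  obtain ⟨η, -, h⟩ := exists_driftRatios_bound hQ hproper b
  exact ⟨1 - η, h⟩

theorem driftLambda_lt_one (hQ : Q.PosDef ∨ Q = 0) (hproper : ProperPosterior X Y Q v)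
    (b : Fin p → ℝ) : driftLambda X Y Q b < 1 := by
  obtain ⟨η, hη, h⟩ := exists_driftRatios_bound hQ hproper b
  rcases (driftRatios X Y Q b).eq_empty_or_nonempty with he | hne
  · rw [driftLambda, he, Real.sSup_empty]
    exact one_pos
  · have := csSup_le hne h
    rw [driftLambda]
    linarith

theorem driftLambda_nonneg (b : Fin p → ℝ) : 0 ≤ driftLambda X Y Q b := by
  refine Real.sSup_nonneg ?_
  rintro x ⟨t, -, α, -, rfl⟩
  exact div_nonneg (sqNorm_nonneg _) (sqNorm_nonneg _)

theorem quad_driftVec_le (hQ : Q.PosDef ∨ Q = 0) (hproper : ProperPosterior X Y Q v)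
    (b α : Fin p → ℝ) {t : ℝ} (ht : t ∈ Set.Ioo (0 : ℝ) 1) :
    driftVec X Y b α t ⬝ᵥ ((sigmaMat X Q)⁻¹ *ᵥ driftVec X Y b α t) ≤
      driftLambda X Y Q b * (α ⬝ᵥ (sigmaMat X Q *ᵥ α)) := by
  have hS := sigmaMat_posDef hQ hproper
  by_cases hα : α = 0
  · simp [hα, driftVec]
  rw [← div_le_iff₀ (quad_pos hS hα)]
  refine le_csSup (bddAbove_driftRatios hQ hproper b) ?_
  rw [driftRatios_eq hS]
  exact ⟨t, ht, α, hα, rfl⟩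

/-- Mean value bound for the expected update. -/
theorem quad_meanVec_sub_le (hQ : Q.PosDef ∨ Q = 0) (hproper : ProperPosterior X Y Q v)
    (b β : Fin p → ℝ) :
    (Xᵀ *ᵥ (meanVec X Y β - meanVec X Y b)) ⬝ᵥ
      ((sigmaMat X Q)⁻¹ *ᵥ (Xᵀ *ᵥ (meanVec X Y β - meanVec X Y b))) ≤
      driftLambda X Y Q b * ((β - b) ⬝ᵥ (sigmaMat X Q *ᵥ (β - b))) := by
  have hS := sigmaMat_posDef hQ hproper
  have hI := hS.inv.posSemidef
  set A := (sigmaMat X Q)⁻¹ with hA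
  set Δ := Xᵀ *ᵥ (meanVec X Y β - meanVec X Y b) with hΔ
  set α := β - b with hα
  -- Pairing with Σ⁻¹Δ makes the curve scalar, so the mean value theorem yields one t in (0, 1), the
  -- range of the supremum defining λ.
  have hderiv : ∀ t : ℝ, HasDerivAt
      (fun t : ℝ => (X *ᵥ (A *ᵥ Δ)) ⬝ᵥ meanVec X Y (b + t • α))
      ((X *ᵥ (A *ᵥ Δ)) ⬝ᵥ (dMat X Y (b + t • α) *ᵥ (X *ᵥ α))) t := by
    intro t
    refine HasDerivAt.fun_sum fun i _ => HasDerivAt.const_mul _ ?_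
    have e1 : HasDerivAt (fun t : ℝ => (X *ᵥ (b + t • α)) i) ((X *ᵥ α) i) t := by
      simp only [mulVec_add, mulVec_smul, Pi.add_apply, Pi.smul_apply, smul_eq_mul]
      simpa using ((hasDerivAt_id t).mul_const ((X *ᵥ α) i)).const_add ((X *ᵥ b) i)
    rw [dMat_mulVec_apply]
    exact (hasDerivAt_truncMean _ (Y i)).comp t e1
  obtain ⟨t, ht, hslope⟩ := exists_hasDerivAt_eq_slope
    (fun t : ℝ => (X *ᵥ (A *ᵥ Δ)) ⬝ᵥ meanVec X Y (b + t • α)) _ zero_lt_one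
    (fun t _ => (hderiv t).continuousAt.continuousWithinAt) (fun t _ => hderiv t)
  have hend : b + (1 : ℝ) • α = β := by rw [hα, one_smul]; abel
  rw [hend, zero_smul, add_zero, sub_zero, div_one, ← dotProduct_sub,
    mulVec_dotProduct_eq (X := X), mulVec_dotProduct_eq (X := X), ← hΔ] at hslope
  -- Since driftVec and Δ have the same Σ⁻¹-pairing with Δ, expanding this square gives that the
  -- Σ⁻¹-norm of Δ is at most that of driftVec.
  have h1 := quad_nonneg hI (Δ - driftVec X Y b α t)
  have h2 := quad_comm hI Δ (driftVec X Y b α t)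
  have h3 : (A *ᵥ Δ) ⬝ᵥ driftVec X Y b α t = (A *ᵥ Δ) ⬝ᵥ Δ := hslope
  rw [dotProduct_comm (A *ᵥ Δ) Δ, dotProduct_comm] at h3
  simp only [mulVec_sub, sub_dotProduct, dotProduct_sub] at h1
  have h4 := quad_driftVec_le hQ hproper b α ht
  linarith

/-- Two modes are two fixed points of the expected update, which contracts squared distances to one
of them by λ < 1. -/
theorem IsPosteriorMode.eq (hQ : Q.PosDef ∨ Q = 0) (hproper : ProperPosterior X Y Q v)
    {b b' : Fin p → ℝ} (hb : IsPosteriorMode X Y Q v b) (hb' : IsPosteriorMode X Y Q v b') :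
    b' = b := by
  have hS := sigmaMat_posDef hQ hproper
  have h1 := hb.sigmaMat_mulVec hQ hproper
  have h2 := hb'.sigmaMat_mulVec hQ hproper
  have h3 : Xᵀ *ᵥ (meanVec X Y b' - meanVec X Y b) = sigmaMat X Q *ᵥ (b' - b) := by
    rw [mulVec_sub, mulVec_sub, h1, h2]; abel
  have h4 := quad_meanVec_sub_le hQ hproper b b'
  rw [h3, inv_mulVec_mulVec hS, dotProduct_comm] at h4
  by_contra hne
  have h5 := quad_pos hS (sub_ne_zero.2 hne)
  have h6 := driftLambda_lt_one hQ hproper b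
  nlinarith

theorem existsUnique_posteriorMode (hQ : Q.PosDef ∨ Q = 0)
    (hproper : ProperPosterior X Y Q v) : ∃! b, IsPosteriorMode X Y Q v b := by
  obtain ⟨b, hb⟩ := exists_posteriorMode hQ hproper
  exact ⟨b, hb, fun _ hb' => hb.eq hQ hproper hb'⟩

/-! ### The two kernels and the drift function -/

theorem measurable_latentPDF :
    Measurable fun q : (Fin p → ℝ) × (Fin n → ℝ) => latentPDF X Y q.1 q.2 := by
  have h : ∀ i, Measurable fun q : (Fin p → ℝ) × (Fin n → ℝ) =>
      truncNormalPDF ((X *ᵥ q.1) i) (Y i) (q.2 i) := by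
    intro i
    have h1 : Continuous fun q : (Fin p → ℝ) × (Fin n → ℝ) => X *ᵥ q.1 := by fun_prop
    have h2 : Measurable fun q : (Fin p → ℝ) × (Fin n → ℝ) => (X *ᵥ q.1) i :=
      measurable_pi_iff.1 h1.measurable i
    have h3 : Measurable fun q : (Fin p → ℝ) × (Fin n → ℝ) => q.2 i :=
      measurable_pi_iff.1 measurable_snd i
    have h4 := (measurable_truncNormalPDF (Y i)).comp (h2.prodMk h3)
    simpa only [Function.comp_def] using h4
  simp only [latentPDF]
  exact Finset.measurable_fun_prod _ fun i _ => h i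

theorem isMarkovDensity_latentPDF : IsMarkovDensity volume (latentPDF X Y) where
  measurable := measurable_latentPDF
  nonneg _ _ := Finset.prod_nonneg fun _ _ => truncNormalPDF_nonneg _ _ _
  integrable β := integrable_prod_density (f := fun i => truncNormalPDF ((X *ᵥ β) i) (Y i))
    fun _ k => integrable_pow_mul_truncNormalPDF _ _ k
  integral_eq_one β := integral_prod_density
    (f := fun i => truncNormalPDF ((X *ᵥ β) i) (Y i)) fun _ => integral_truncNormalPDF _ _

theorem latentMean_eq (β : Fin p → ℝ) : latentMean X Y β = meanVec X Y β := by
  ext i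
  exact integral_coord_mul (f := fun i => truncNormalPDF ((X *ᵥ β) i) (Y i))
    (fun i => integral_truncNormalPDF _ _) (fun i => integral_mul_truncNormalPDF _ _) i

theorem continuous_condMean : Continuous (condMean X Q v) := by
  unfold condMean
  fun_prop

/-- The density of the new state given the latent vector. -/
def statePDF (X : Matrix (Fin n) (Fin p) ℝ) (Q : Matrix (Fin p) (Fin p) ℝ) (v : Fin p → ℝ)
    (z : Fin n → ℝ) (b : Fin p → ℝ) : ℝ :=
  mvnPDF (condMean X Q v z) (sigmaMat X Q)⁻¹ b

theorem isMarkovDensity_statePDF (hS : (sigmaMat X Q).PosDef) :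
    IsMarkovDensity volume (statePDF X Q v) where
  measurable := ((continuous_mvnPDF (sigmaMat X Q)⁻¹).comp
    ((continuous_condMean.comp continuous_fst).prodMk continuous_snd)).measurable
  nonneg _ _ := mvnPDF_nonneg _ _ _
  integrable _ := integrable_mvnPDF hS _
  integral_eq_one _ := integral_mvnPDF hS _

/-- The drift function, a squared Mahalanobis distance to `b`. -/
def driftFun (X : Matrix (Fin n) (Fin p) ℝ) (Q : Matrix (Fin p) (Fin p) ℝ) (v b : Fin p → ℝ)
    (z : Fin n → ℝ) : ℝ :=
  (condMean X Q v z - b) ⬝ᵥ (sigmaMat X Q *ᵥ (condMean X Q v z - b))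

/-- Writing b as the update of c makes V a quadratic form in z - c with the hat matrix. Its latent
mean then splits into a bias term and a trace against D. -/
theorem driftFun_eq (hS : (sigmaMat X Q).PosDef) {b : Fin p → ℝ} {c : Fin n → ℝ}
    (hb : sigmaMat X Q *ᵥ b = Xᵀ *ᵥ c + Q *ᵥ v) (z : Fin n → ℝ) :
    driftFun X Q v b z = (z - c) ⬝ᵥ ((X * (sigmaMat X Q)⁻¹ * Xᵀ) *ᵥ (z - c)) := by
  have h1 : condMean X Q v z - b = (sigmaMat X Q)⁻¹ *ᵥ (Xᵀ *ᵥ (z - c)) := by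
    have : b = (sigmaMat X Q)⁻¹ *ᵥ (Xᵀ *ᵥ c + Q *ᵥ v) := by
      rw [← hb, inv_mulVec_mulVec hS]
    rw [condMean]
    nth_rewrite 1 [this]
    rw [← mulVec_sub, mulVec_sub Xᵀ]
    congr 1
    abel
  rw [driftFun, h1, mulVec_inv_mulVec hS, ← mulVec_mulVec, ← mulVec_mulVec,
    ← mulVec_dotProduct_eq, dotProduct_comm]

section Drift

variable {b : Fin p → ℝ}

theorem integrable_latentPDF_mul_driftFun (hS : (sigmaMat X Q).PosDef)
    (hb : sigmaMat X Q *ᵥ b = Xᵀ *ᵥ meanVec X Y b + Q *ᵥ v) (β : Fin p → ℝ) :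
    Integrable (fun z => latentPDF X Y β z * driftFun X Q v b z) := by
  simp_rw [driftFun_eq hS hb, mul_comm (latentPDF X Y β _)]
  exact integrable_quad_mul_prod (f := fun i => truncNormalPDF ((X *ᵥ β) i) (Y i))
    (fun i k => integrable_pow_mul_truncNormalPDF _ _ k) _ _

theorem densOp_driftFun (hS : (sigmaMat X Q).PosDef)
    (hb : sigmaMat X Q *ᵥ b = Xᵀ *ᵥ meanVec X Y b + Q *ᵥ v) (β : Fin p → ℝ) :
    densOp volume (latentPDF X Y) (driftFun X Q v b) β =
      driftFun X Q v b (meanVec X Y β) + ∑ i, (X * (sigmaMat X Q)⁻¹ * Xᵀ) i i *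
        (1 - gFun (signedPred X Y β i)) := by
  simp_rw [densOp, driftFun_eq hS hb, mul_comm (latentPDF X Y β _)]
  exact integral_quad_mul_prod (f := fun i => truncNormalPDF ((X *ᵥ β) i) (Y i))
    (fun i k => integrable_pow_mul_truncNormalPDF _ _ k)
    (fun i => integral_truncNormalPDF _ _) (fun i => integral_mul_truncNormalPDF _ _)
    (fun i => integral_sq_mul_truncNormalPDF _ _) _ _

theorem densOp_driftFun_le (hS : (sigmaMat X Q).PosDef)
    (hb : sigmaMat X Q *ᵥ b = Xᵀ *ᵥ meanVec X Y b + Q *ᵥ v) (β : Fin p → ℝ) :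
    densOp volume (latentPDF X Y) (driftFun X Q v b) β ≤
      driftFun X Q v b (meanVec X Y β) + (X * (sigmaMat X Q)⁻¹ * Xᵀ).trace := by
  rw [densOp_driftFun hS hb]
  have hP : (X * (sigmaMat X Q)⁻¹ * Xᵀ).PosSemidef := by
    have := hS.inv.posSemidef.mul_mul_conjTranspose_same X
    rwa [conjTranspose_eq_transpose_of_trivial] at this
  refine add_le_add_right (Finset.sum_le_sum fun i _ => ?_) _
  have h1 : 0 ≤ (X * (sigmaMat X Q)⁻¹ * Xᵀ) i i := hP.diag_nonneg
  exact mul_le_of_le_one_right h1 (sub_le_self 1 (gFun_pos _).le)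

/-- The bias is controlled by the contraction, and the variance by the trace of the hat matrix, at
most p. -/
theorem densOp_driftFun_le_quad (hQ : Q.PosDef ∨ Q = 0) (hproper : ProperPosterior X Y Q v)
    (hb : sigmaMat X Q *ᵥ b = Xᵀ *ᵥ meanVec X Y b + Q *ᵥ v) (β : Fin p → ℝ) :
    densOp volume (latentPDF X Y) (driftFun X Q v b) β ≤
      driftLambda X Y Q b * ((β - b) ⬝ᵥ (sigmaMat X Q *ᵥ (β - b))) + p := by
  have hS := sigmaMat_posDef hQ hproper
  have h1 := densOp_driftFun_le hS hb β
  have h2 := trace_hat_le (posSemidef_of_posDef_or_zero hQ) hS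
  have h3 := quad_meanVec_sub_le hQ hproper b β
  rw [driftFun_eq hS hb, ← mulVec_mulVec, ← mulVec_mulVec, ← dotProduct_comm,
    mulVec_dotProduct_eq, dotProduct_comm] at h1
  linarith

theorem driftFun_nonneg (hS : (sigmaMat X Q).PosDef) (z : Fin n → ℝ) :
    0 ≤ driftFun X Q v b z := quad_nonneg hS.posSemidef _

theorem measurable_driftFun : Measurable (driftFun X Q v b) :=
  ((continuous_quad (sigmaMat X Q)).comp
    (continuous_condMean.sub continuous_const)).measurable

/-- Under N(condMean, Σ⁻¹) the mean squared Σ-distance to b is V(z) + p, so the drift becomes λ(V +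
p) + p = λV + L. The minorizing density is ε times the Gaussian centred at b with covariance (2Σ)⁻¹.
-/
theorem driftMinorization (hQ : Q.PosDef ∨ Q = 0) (hproper : ProperPosterior X Y Q v)
    (hb : sigmaMat X Q *ᵥ b = Xᵀ *ᵥ meanVec X Y b + Q *ᵥ v) (d : ℝ) :
    DriftMinorization volume volume (statePDF X Q v) (latentPDF X Y) (driftFun X Q v b)
      (fun x => minorEps p d * mvnPDF b ((2 : ℝ) • sigmaMat X Q)⁻¹ x)
      (driftLambda X Y Q b) (driftL p (driftLambda X Y Q b)) d (minorEps p d) := by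
  have hS := sigmaMat_posDef hQ hproper
  have hS2 : ((2 : ℝ) • sigmaMat X Q).PosDef := hS.smul two_pos
  have hε : 0 ≤ minorEps p d := by unfold minorEps; positivity
  have hdS := isMarkovDensity_statePDF (v := v) hS
  have hdT := isMarkovDensity_latentPDF (X := X) (Y := Y)
  have hW0 : ∀ β, 0 ≤ densOp volume (latentPDF X Y) (driftFun X Q v b) β := fun β =>
    integral_nonneg fun z => mul_nonneg (hdT.nonneg β z) (driftFun_nonneg hS z)
  have hdom : ∀ z, Integrable (fun β => statePDF X Q v z β *
      (driftLambda X Y Q b * ((β - b) ⬝ᵥ (sigmaMat X Q *ᵥ (β - b))) + p)) := fun z =>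
    hdS.integrable_affine (integrable_mvnPDF_mul_quad hS _ _) _ _
  have hSW : ∀ z, Integrable (fun β => statePDF X Q v z β *
      densOp volume (latentPDF X Y) (driftFun X Q v b) β) := fun z => by
    refine (hdom z).mono' ((hdS.integrable z).aestronglyMeasurable.mul
      (hdT.measurable_densOp measurable_driftFun).aestronglyMeasurable) (.of_forall fun β => ?_)
    rw [Real.norm_of_nonneg (mul_nonneg (hdS.nonneg z β) (hW0 β))]
    exact mul_le_mul_of_nonneg_left (densOp_driftFun_le_quad hQ hproper hb β) (hdS.nonneg z β)
  refine
  { densS := hdS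
    densT := hdT
    measV := measurable_driftFun
    nonnegV := driftFun_nonneg hS
    integrableT := integrable_latentPDF_mul_driftFun hS hb
    integrableS := hSW
    drift := fun z => ?_
    integrableψ := (integrable_mvnPDF hS2 b).const_mul _
    nonnegψ := fun x => mul_nonneg hε (mvnPDF_nonneg _ _ _)
    integralψ := by rw [integral_const_mul, integral_mvnPDF hS2, mul_one]
    measψ := ((continuous_mvnPDF _).comp
      (continuous_const.prodMk continuous_id)).measurable.const_mul _
    minor := fun z hz x => le_mvnPDF hS hz x }
  have h1 := hdS.densOp_mono (hSW z) (hdom z) (densOp_driftFun_le_quad hQ hproper hb)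
  rw [hdS.densOp_affine (integrable_mvnPDF_mul_quad hS _ _)] at h1
  have h2 : densOp volume (statePDF X Q v) (fun β => (β - b) ⬝ᵥ (sigmaMat X Q *ᵥ (β - b))) z =
      driftFun X Q v b z + p := integral_mvnPDF_mul_quad hS _ _
  rw [h2] at h1
  rw [driftL]
  linarith

end Drift

/-! ### Invariance of the posterior under the two-stage chain -/

/-- Stationarity of the marginal of a joint density with the given conditional densities. -/
theorem integral_densOp_densOp_eq {E G : Type*} [MeasurableSpace E] [MeasurableSpace G]
    {μ : Measure E} {ν : Measure G} [SFinite μ] [SFinite ν] {S : G → E → ℝ} {T : E → G → ℝ}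
    (hS : IsMarkovDensity μ S) (hT : IsMarkovDensity ν T) {π : E → ℝ} (hπm : Measurable π)
    (hπ0 : ∀ b, 0 ≤ π b) (hπi : Integrable π μ) (hπ1 : ∫ b, π b ∂μ = 1) {c : G → ℝ}
    (hc : ∀ b z, π b * T b z = c z * S z b) {f : E → ℝ} (hf : Measurable f) {C : ℝ}
    (hC : ∀ b, |f b| ≤ C) :
    ∫ b, π b * densOp ν T (densOp μ S f) b ∂μ = ∫ b, π b * f b ∂μ := by
  have hπ : IsMarkovDensity μ (fun (_ : Unit) => π) :=
    ⟨hπm.comp measurable_snd, fun _ => hπ0, fun _ => hπi, fun _ => hπ1⟩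
  have hJ : Integrable (fun q : E × G => π q.1 * T q.1 q.2) (μ.prod ν) := by
    simpa using hπ.integrable_comp_integrand hT () (g := fun _ => 1) (C := 1) measurable_const
      (by simp)
  have hg := hS.measurable_densOp hf
  have hgb := hS.abs_densOp_le hf hC
  have hJg : Integrable (fun q : E × G => π q.1 * T q.1 q.2 * densOp μ S f q.2) (μ.prod ν) :=
    integrable_mul_of_abs_le hJ (hg.comp measurable_snd) fun q => hgb q.2
  have hJf : Integrable (fun q : E × G => π q.1 * T q.1 q.2 * f q.1) (μ.prod ν) :=
    integrable_mul_of_abs_le hJ (hf.comp measurable_fst) fun q => hC q.1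
  calc ∫ b, π b * densOp ν T (densOp μ S f) b ∂μ
      = ∫ b, ∫ z, π b * T b z * densOp μ S f z ∂ν ∂μ := by
        simp_rw [densOp, ← integral_const_mul, mul_assoc]
    _ = ∫ z, ∫ b, π b * T b z * densOp μ S f z ∂μ ∂ν :=
        integral_integral_swap (f := fun b z => π b * T b z * densOp μ S f z) hJg
    -- In the form c(z)S(z, b), integrating out b costs nothing because S has mass one; the same
    -- factorization then restores the joint density with f inside.
    _ = ∫ z, c z * densOp μ S f z ∂ν := by
        refine integral_congr_ae (.of_forall fun z => ?_)
        simp only [hc]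
        rw [integral_mul_const, integral_const_mul, hS.integral_eq_one, mul_one]
    _ = ∫ z, ∫ b, π b * T b z * f b ∂μ ∂ν := by
        refine integral_congr_ae (.of_forall fun z => ?_)
        simp only [hc, densOp, mul_assoc]
        rw [integral_const_mul]
    _ = ∫ b, ∫ z, π b * T b z * f b ∂ν ∂μ :=
        (integral_integral_swap (f := fun b z => π b * T b z * f b) hJf).symm
    _ = ∫ b, π b * f b ∂μ := by
        refine integral_congr_ae (.of_forall fun b => ?_)
        simp only
        rw [integral_mul_const, integral_const_mul, hT.integral_eq_one, mul_one]

/-- The likelihood factor is the normalizer of the truncated density, so the product is Gaussian in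
θ and the truncation only restricts t. -/
theorem stdCDF_mul_truncNormalPDF (θ : ℝ) (y : Bool) (t : ℝ) :
    stdCDF (sgn y * θ) * truncNormalPDF θ y t =
      (if 0 < sgn y * t then (Real.sqrt (2 * Real.pi))⁻¹ else 0) *
        Real.exp (-(1 / 2) * ((θ - t) * (θ - t))) := by
  rw [truncNormalPDF_eq, posTruncPDF]
  by_cases h : 0 < sgn y * t
  · rw [Set.indicator_of_mem (show sgn y * t ∈ Set.Ioi 0 from h), if_pos h, stdCDF_eq,
      mul_assoc, mul_div_cancel₀ _ (tiltMoment_pos 0 _).ne', stdPDF_eq, mul_assoc,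
      ← Real.exp_add]
    congr 2
    linear_combination (θ * t - θ ^ 2 / 2 - t ^ 2 / 2) * sgn_mul_self y
  · rw [Set.indicator_of_notMem (show sgn y * t ∉ Set.Ioi 0 from h), if_neg h]
    simp

theorem likelihood_mul_latentPDF (β : Fin p → ℝ) (z : Fin n → ℝ) :
    likelihood X Y β * latentPDF X Y β z =
      (∏ i, if 0 < sgn (Y i) * z i then (Real.sqrt (2 * Real.pi))⁻¹ else 0) *
        Real.exp (-(1 / 2) * ((X *ᵥ β - z) ⬝ᵥ (X *ᵥ β - z))) := by
  rw [likelihood_eq, latentPDF, ← Finset.prod_mul_distrib, dotProduct, Finset.mul_sum,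
    Real.exp_sum, ← Finset.prod_mul_distrib]
  exact Finset.prod_congr rfl fun i _ => stdCDF_mul_truncNormalPDF _ _ _

theorem complete_square (hQ : Q.PosSemidef) (hS : (sigmaMat X Q).PosDef) (β : Fin p → ℝ)
    (z : Fin n → ℝ) :
    (X *ᵥ β - z) ⬝ᵥ (X *ᵥ β - z) + (β - v) ⬝ᵥ (Q *ᵥ (β - v)) =
      (β - condMean X Q v z) ⬝ᵥ (sigmaMat X Q *ᵥ (β - condMean X Q v z)) +
        (z ⬝ᵥ z + v ⬝ᵥ (Q *ᵥ v) -
          condMean X Q v z ⬝ᵥ (sigmaMat X Q *ᵥ condMean X Q v z)) := by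
  have h1 : sigmaMat X Q *ᵥ condMean X Q v z = Xᵀ *ᵥ z + Q *ᵥ v := by
    rw [condMean, mulVec_inv_mulVec hS]
  have h2 := quad_sigmaMat (X := X) (Q := Q) β
  have h3 := quad_comm hS.posSemidef (condMean X Q v z) β
  have h4 := quad_comm hQ v β
  have h5 : β ⬝ᵥ (sigmaMat X Q *ᵥ condMean X Q v z) = (X *ᵥ β) ⬝ᵥ z + β ⬝ᵥ (Q *ᵥ v) := by
    rw [h1, dotProduct_add, mulVec_dotProduct_eq]
  simp only [mulVec_sub, sub_dotProduct, dotProduct_sub, dotProduct_comm z (X *ᵥ β)]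
  linarith

/-- Completing the square in β identifies the conditional law of β given z under the joint density
as the Gaussian that the chain draws from. -/
theorem exists_joint_factorization (hQ : Q.PosSemidef) (hS : (sigmaMat X Q).PosDef) :
    ∃ c : (Fin n → ℝ) → ℝ, ∀ β z,
      posterior X Y Q v β * latentPDF X Y β z = c z * statePDF X Q v z β := by
  set k := (Real.sqrt ((2 * Real.pi) ^ p))⁻¹ * |(matSqrt (sigmaMat X Q)).det| with hk
  have hk0 : k ≠ 0 := by
    have := abs_pos.2 (det_matSqrt_ne_zero hS)
    positivity
  refine ⟨fun z => (∏ i, if 0 < sgn (Y i) * z i then (Real.sqrt (2 * Real.pi))⁻¹ else 0) *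
    Real.exp (-(1 / 2) * (z ⬝ᵥ z + v ⬝ᵥ (Q *ᵥ v) -
      condMean X Q v z ⬝ᵥ (sigmaMat X Q *ᵥ condMean X Q v z))) *
      (k⁻¹ * (∫ b, unnormPosterior X Y Q v b)⁻¹), fun β z => ?_⟩
  have h1 := likelihood_mul_latentPDF (X := X) (Y := Y) β z
  rw [posterior, unnormPosterior, statePDF, mvnPDF_inv hS, ← hk, prior]
  have h2 : Real.exp (-(1 / 2) * ((X *ᵥ β - z) ⬝ᵥ (X *ᵥ β - z))) *
      Real.exp (-(1 / 2) * ((β - v) ⬝ᵥ (Q *ᵥ (β - v)))) =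
      Real.exp (-(1 / 2) * ((β - condMean X Q v z) ⬝ᵥ
        (sigmaMat X Q *ᵥ (β - condMean X Q v z)))) *
      Real.exp (-(1 / 2) * (z ⬝ᵥ z + v ⬝ᵥ (Q *ᵥ v) -
        condMean X Q v z ⬝ᵥ (sigmaMat X Q *ᵥ condMean X Q v z))) := by
    rw [← Real.exp_add, ← Real.exp_add, ← mul_add, ← mul_add, complete_square hQ hS]
  rw [div_eq_mul_inv, mul_right_comm _ _ (latentPDF X Y β z), mul_right_comm (likelihood X Y β), h1,
    mul_assoc _ (Real.exp _) (Real.exp _), h2]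
  field_simp

/-! ### The m-step density as an iterated two-stage operator -/

theorem acMtd_eq : acMtd X Y Q v = compDensity volume (latentPDF X Y) (statePDF X Q v) := by
  ext β β'
  simp only [acMtd, compDensity, statePDF, mul_comm]

theorem isMarkovDensity_acMtd (hS : (sigmaMat X Q).PosDef) :
    IsMarkovDensity volume (acMtd X Y Q v) := by
  rw [acMtd_eq]
  exact isMarkovDensity_latentPDF.comp (isMarkovDensity_statePDF hS)

theorem acMtdStep_add_two (m : ℕ) : acMtdStep X Y Q v (m + 2) =
    compDensity volume (acMtd X Y Q v) (acMtdStep X Y Q v (m + 1)) := rfl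

theorem isMarkovDensity_acMtdStep (hS : (sigmaMat X Q).PosDef) (m : ℕ) :
    IsMarkovDensity volume (acMtdStep X Y Q v (m + 1)) := by
  induction m with
  | zero => exact isMarkovDensity_acMtd hS
  | succ m ih =>
    rw [acMtdStep_add_two]
    exact (isMarkovDensity_acMtd hS).comp ih

/-- Regrouping (TS)^{m+1} as T(ST)^m S leaves only m contracting steps on the latent space, hence
the exponent m - 1 in the final bound. -/
theorem densOp_acMtdStep (hS : (sigmaMat X Q).PosDef) {g : (Fin p → ℝ) → ℝ} {C : ℝ}
    (hg : Measurable g) (hC : ∀ b, |g b| ≤ C) (m : ℕ) :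
    densOp volume (acMtdStep X Y Q v (m + 1)) g = densOp volume (latentPDF X Y)
      ((pairOp volume volume (statePDF X Q v) (latentPDF X Y))^[m]
        (densOp volume (statePDF X Q v) g)) := by
  have hdS := isMarkovDensity_statePDF (v := v) hS
  have hdT := isMarkovDensity_latentPDF (X := X) (Y := Y)
  have hone : ∀ {f : (Fin p → ℝ) → ℝ}, Measurable f → (∀ b, |f b| ≤ C) →
      densOp volume (acMtd X Y Q v) f =
        densOp volume (latentPDF X Y) (densOp volume (statePDF X Q v) f) := by
    intro f hf hfC
    ext β
    rw [acMtd_eq]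
    exact hdT.densOp_comp hdS hf hfC β
  induction m with
  | zero => exact hone hg hC
  | succ m ih =>
    have hdm := isMarkovDensity_acMtdStep (Y := Y) (v := v) hS m
    have e : densOp volume (acMtdStep X Y Q v (m + 1 + 1)) g =
        densOp volume (acMtd X Y Q v) (densOp volume (acMtdStep X Y Q v (m + 1)) g) := by
      ext β
      rw [acMtdStep_add_two]
      exact (isMarkovDensity_acMtd hS).densOp_comp hdm hg hC β
    rw [e, hone (hdm.measurable_densOp hg) (hdm.abs_densOp_le hg hC), ih,
      Function.iterate_succ_apply']
    rfl

/-! ### The L¹ bound -/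

theorem measurable_posterior : Measurable (posterior X Y Q v) :=
  continuous_unnormPosterior.measurable.div_const _

theorem posterior_nonneg (hproper : ProperPosterior X Y Q v) (β : Fin p → ℝ) :
    0 ≤ posterior X Y Q v β :=
  div_nonneg (unnormPosterior_pos β).le (integral_unnormPosterior_pos hproper).le

theorem integrable_posterior (hproper : ProperPosterior X Y Q v) :
    Integrable (posterior X Y Q v) := hproper.div_const _

theorem integral_posterior (hproper : ProperPosterior X Y Q v) :
    ∫ β, posterior X Y Q v β = 1 := by
  simp only [posterior]
  rw [integral_div, div_self (integral_unnormPosterior_pos hproper).ne']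

/-- The total variation integral is attained at a sign function. -/
theorem exists_sign_integral {E : Type*} [MeasurableSpace E] {μ : Measure E} {f g : E → ℝ}
    (hf : Measurable f) (hg : Measurable g) (hfi : Integrable f μ) (hgi : Integrable g μ) :
    ∃ σ : E → ℝ, Measurable σ ∧ (∀ x, |σ x| ≤ 1) ∧
      ∫ x, |f x - g x| ∂μ = (∫ x, f x * σ x ∂μ) - ∫ x, g x * σ x ∂μ := by
  classical
  have hm : Measurable fun x => if g x ≤ f x then (1 : ℝ) else -1 :=
    Measurable.ite (measurableSet_le hg hf) measurable_const measurable_const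
  have hb : ∀ x, |if g x ≤ f x then (1 : ℝ) else -1| ≤ 1 := fun x => by split_ifs <;> simp
  refine ⟨_, hm, hb, ?_⟩
  rw [← integral_sub (integrable_mul_of_abs_le hfi hm hb) (integrable_mul_of_abs_le hgi hm hb)]
  refine integral_congr_ae (.of_forall fun x => ?_)
  simp only
  split_ifs with h
  · rw [abs_of_nonneg (sub_nonneg.2 h)]; ring
  · rw [abs_of_nonpos (by linarith)]; ring

theorem hBound_eq (hS : (sigmaMat X Q).PosDef) (b β : Fin p → ℝ) (lam L : ℝ) :
    hBound X Y Q v b lam L β = 2 + L / (1 - lam) + (X * (sigmaMat X Q)⁻¹ * Xᵀ).trace +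
      driftFun X Q v b (meanVec X Y β) := by
  rw [hBound, latentMean_eq, sqNorm_matSqrt_mulVec hS.posSemidef, driftFun]

theorem trace_hat_nonneg (hS : (sigmaMat X Q).PosDef) :
    0 ≤ (X * (sigmaMat X Q)⁻¹ * Xᵀ).trace := by
  have := (hS.inv.posSemidef.mul_mul_conjTranspose_same X).trace_nonneg
  rwa [conjTranspose_eq_transpose_of_trivial] at this

theorem minorEps_pos (p : ℕ) (d : ℝ) : 0 < minorEps p d := by
  unfold minorEps; positivity

theorem minorEps_le_exp (p : ℕ) (d : ℝ) : minorEps p d ≤ Real.exp (-d) := by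
  refine mul_le_of_le_one_left (Real.exp_pos _).le ?_
  exact Real.rpow_le_one_of_one_le_of_nonpos one_le_two
    (by have : (0 : ℝ) ≤ p := p.cast_nonneg
        linarith)

theorem integral_abs_sub_le (hQ : Q.PosDef ∨ Q = 0) (hproper : ProperPosterior X Y Q v)
    {b : Fin p → ℝ} (hb : IsPosteriorMode X Y Q v b) (hp : 0 < p) {d r : ℝ}
    (hd : 2 * driftL p (driftLambda X Y Q b) / (1 - driftLambda X Y Q b) < d)
    (hr0 : 0 < r) (M : ℕ) (β : Fin p → ℝ) :
    ∫ β', |acMtdStep X Y Q v (M + 1) β β' - posterior X Y Q v β'| ≤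
      hBound X Y Q v b (driftLambda X Y Q b) (driftL p (driftLambda X Y Q b)) β *
        rhoHat (driftLambda X Y Q b) (driftL p (driftLambda X Y Q b)) (minorEps p d) d r ^ M := by
  have hS := sigmaMat_posDef hQ hproper
  have hQs := posSemidef_of_posDef_or_zero hQ
  have hfix := hb.sigmaMat_mulVec hQ hproper
  have hl0 := driftLambda_nonneg (X := X) (Y := Y) (Q := Q) b
  have hl1 := driftLambda_lt_one hQ hproper b
  have hDM := driftMinorization hQ hproper hfix d
  set lam := driftLambda X Y Q b with hlam
  set L := driftL p lam with hLdef
  have hp1 : (1 : ℝ) ≤ p := by exact_mod_cast hp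
  have hL : 1 ≤ L := by
    rw [hLdef, driftL]
    nlinarith
  -- With L ≥ 1 and 0 ≤ λ the threshold for d is at least 2, so ε ≤ e^{-d} ≤ 1/2, as the rate lemma
  -- requires.
  have hd2 : 2 < d := by
    refine lt_of_le_of_lt ?_ hd
    rw [le_div_iff₀ (by linarith)]
    linarith
  have hε0 := minorEps_pos p d
  have hε1 : minorEps p d ≤ 1 / 2 := by
    refine (minorEps_le_exp p d).trans ?_
    rw [Real.exp_neg, one_div]
    exact inv_anti₀ two_pos (by linarith [Real.add_one_le_exp d])
  obtain ⟨s, κ, hs0, hs1, hκ, hout, hin, hρ⟩ :=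
    exists_contraction_rate hl0 hl1 hL hd hε0 hε1 hr0
  have hk := isMarkovDensity_acMtdStep (Y := Y) (v := v) hS M
  obtain ⟨σ, hσm, hσb, hσ⟩ := exists_sign_integral
    (f := acMtdStep X Y Q v (M + 1) β) (hk.measurable.comp (measurable_prodMk_left (x := β))) measurable_posterior (hk.integrable β)
    (integrable_posterior hproper)
  obtain ⟨c, hc⟩ := exists_joint_factorization (Y := Y) (v := v) hQs hS
  have hmain := hDM.abs_sub_le hl0 hl1 hL (by linarith) hε0.le (by linarith) hs0 hs1 hκ hout hin
    (posterior_nonneg hproper) (integrable_posterior hproper) (integral_posterior hproper)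
    (fun f hf ⟨C, hC⟩ => integral_densOp_densOp_eq hDM.densS hDM.densT measurable_posterior
      (posterior_nonneg hproper) (integrable_posterior hproper) (integral_posterior hproper)
      hc hf hC) hσm hσb M β
  rw [← densOp_acMtdStep hS hσm hσb] at hmain
  have hW := densOp_driftFun_le (Y := Y) hS hfix β
  have hW0 := hDM.nonneg_densOp β
  have hLl : 0 ≤ L / (1 - lam) := div_nonneg (by linarith) (by linarith)
  calc _ = (∫ x, acMtdStep X Y Q v (M + 1) β x * σ x) - ∫ x, posterior X Y Q v x * σ x := hσ
    _ ≤ κ ^ M * (2 + L / (1 - lam) + densOp volume (latentPDF X Y) (driftFun X Q v b) β) := hmain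
    _ ≤ rhoHat lam L (minorEps p d) d r ^ M * hBound X Y Q v b lam L β := by
      rw [hBound_eq hS]
      have hκρ := pow_le_pow_left₀ hκ.le hρ M
      refine mul_le_mul hκρ (by linarith) (by linarith) ?_
      exact pow_nonneg (hκ.le.trans hρ) M
    _ = _ := mul_comm _ _

theorem integral_abs_sub_eq_zero_of_subsingleton {E : Type*} [MeasurableSpace E] [Subsingleton E]
    {μ : Measure E} {f g : E → ℝ} (hfi : Integrable f μ) (hgi : Integrable g μ)
    (h : ∫ x, f x ∂μ = ∫ x, g x ∂μ) : ∫ x, |f x - g x| ∂μ = 0 := by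
  have h0 : ∫ x, (f x - g x) ∂μ = 0 := by rw [integral_sub hfi hgi, h, sub_self]
  rcases isEmpty_or_nonempty E with he | ⟨⟨x₀⟩⟩
  · simp [Measure.eq_zero_of_isEmpty μ]
  · have e : (fun x => f x - g x) = fun _ => f x₀ - g x₀ :=
      funext fun x => by rw [Subsingleton.elim x x₀]
    have e' : (fun x => |f x - g x|) = fun _ => |f x₀ - g x₀| :=
      funext fun x => by rw [Subsingleton.elim x x₀]
    rw [e, integral_const, smul_eq_mul] at h0
    rw [e', integral_const, smul_eq_mul, ← abs_of_nonneg (measureReal_nonneg (μ := μ)), ← abs_mul,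
      h0, abs_zero]

end ProbitDA

end

theorem mainTheorem8 {n p : ℕ} (X : Matrix (Fin n) (Fin p) ℝ) (Y : Fin n → Bool)
    (Q : Matrix (Fin p) (Fin p) ℝ) (v : Fin p → ℝ) (hQ : Q.PosDef ∨ Q = 0)
    (hproper : ProbitDA.ProperPosterior X Y Q v) :
    (∃! Bhat : Fin p → ℝ, ProbitDA.IsPosteriorMode X Y Q v Bhat) ∧
    ∀ Bhat : Fin p → ℝ, ProbitDA.IsPosteriorMode X Y Q v Bhat →
    ∀ lam L : ℝ, lam = ProbitDA.driftLambda X Y Q Bhat → L = ProbitDA.driftL p lam →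
      BddAbove (ProbitDA.driftRatios X Y Q Bhat) ∧ lam < 1 ∧
      ∀ d : ℝ, 2 * L / (1 - lam) < d →
      ∀ r : ℝ, 0 < r → r < 1 →
      ∀ m : ℕ, 1 ≤ m → ∀ β : Fin p → ℝ,
        Integrable (fun β' : Fin p → ℝ =>
          |ProbitDA.acMtdStep X Y Q v m β β' - ProbitDA.posterior X Y Q v β'|) volume ∧
        ∫ β' : Fin p → ℝ,
            |ProbitDA.acMtdStep X Y Q v m β β' - ProbitDA.posterior X Y Q v β'| ≤
          ProbitDA.hBound X Y Q v Bhat lam L β *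
            ProbitDA.rhoHat lam L (ProbitDA.minorEps p d) d r ^ (m - 1) := by
  refine ⟨ProbitDA.existsUnique_posteriorMode hQ hproper, ?_⟩
  rintro b hb lam L rfl rfl
  refine ⟨ProbitDA.bddAbove_driftRatios hQ hproper b, ProbitDA.driftLambda_lt_one hQ hproper b, ?_⟩
  intro d hd r hr0 _ m hm β
  obtain ⟨M, rfl⟩ : ∃ M, m = M + 1 := ⟨m - 1, by omega⟩
  have hS := ProbitDA.sigmaMat_posDef hQ hproper
  have hk := ProbitDA.isMarkovDensity_acMtdStep (Y := Y) (v := v) hS M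
  refine ⟨((hk.integrable β).sub (ProbitDA.integrable_posterior hproper)).abs, ?_⟩
  rw [Nat.add_sub_cancel]
  -- For p = 0 one has L = 0 and the rate lemma does not apply. The state space is a point, both
  -- densities integrate to one, and only nonnegativity of the right side remains.
  rcases Nat.eq_zero_or_pos p with rfl | hp
  · rw [ProbitDA.integral_abs_sub_eq_zero_of_subsingleton (hk.integrable β)
      (ProbitDA.integrable_posterior hproper)
      (by rw [hk.integral_eq_one, ProbitDA.integral_posterior hproper])]
    have hL : ProbitDA.driftL 0 (ProbitDA.driftLambda X Y Q b) = 0 := by simp [ProbitDA.driftL]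
    rw [hL] at hd ⊢
    have hd0 : 0 < d := by simpa using hd
    have hε : ProbitDA.minorEps 0 d ≤ 1 :=
      (ProbitDA.minorEps_le_exp 0 d).trans (Real.exp_le_one_iff.2 (by linarith))
    have h1 := ProbitDA.trace_hat_nonneg hS
    have h2 := ProbitDA.driftFun_nonneg (v := v) (b := b) hS (ProbitDA.meanVec X Y β)
    refine mul_nonneg ?_ (pow_nonneg (le_max_of_le_left (Real.rpow_nonneg (by linarith) _)) _)
    rw [ProbitDA.hBound_eq hS, zero_div]
    linarith
  · exact ProbitDA.integral_abs_sub_le hQ hproper hb hp hd hr0 M β
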